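/- Consider a finite simple undirected graph $G=(V,E)$ with $n=|V|$, whose nodes carry distinct, totally ordered identifiers, and a fixed maximal matching $\mathcal M$ of $G$ (the stabilized output of an underlying matching algorithm). Endpoints of edges of $\mathcal M$ are *matched*, all other nodes are *single*; $m_u$ is the partner of a matched node $u$; $N(u)$ is the set of neighbours of $u$, and $\mathrm{single}(A)$, $\mathrm{matched}(A)$ are the sets of single and matched nodes of $A\subseteq V$. Every node $u$ has pointers $p_u,\alpha_u,\beta_u\in V\cup\{null\}$ and booleans $s_u,end_u$ (single nodes use only $p_u$ and $end_u$). Here $null$ is larger than every identifier; $\mathrm{Lowest}(A)$ is the node of $A$ with the lowest identifier ($null$ if $A$ contains no node), and $\mathrm{Unique}(A)$ is the number of distinct nodes in the multiset $A$ ($null$ is not counted). "$p_{p_u}=u$" is false if $p_u=null$. Functions, for a matched node $u$ (evaluated in the current configuration): - $\mathrm{BestRematch}(u)=(a,b)$ with $a=\mathrm{Lowest}\{x\in \mathrm{single}(N(u)) : p_x=u\vee end_x=False\}$ and $b=\mathrm{Lowest}\{x\in \mathrm{single}(N(u))\setminus\{a\} : p_x=u\vee end_x=False\}$. - $\mathrm{AskFirst}(u)=\alpha_u$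 if $\alpha_u\ne null$, $\alpha_{m_u}\neq null$, $\mathrm{Unique}\{\alpha_u,\beta_u,\alpha_{m_u},\beta_{m_u}\}\ge 2$ and [$\alpha_u<\alpha_{m_u}$, or ($\alpha_u=\alpha_{m_u}$ and $\beta_u=null$), or ($\alpha_u=\alpha_{m_u}$ and $\beta_{m_u}\ne null$ and $u<m_u$)]; otherwise $\mathrm{AskFirst}(u)=null$. - $\mathrm{AskSecond}(u)=\mathrm{Lowest}(\{\alpha_u,\beta_u\}\setminus\{\alpha_{m_u}\})$ if $\mathrm{AskFirst}(m_u)\ne null$; otherwise $null$. The algorithm MaxMatch consists of the following rules; in each of the two groups they are listed from the highest to the lowest priority, and all right-hand sides are evaluated in the configuration before the move. Single node $u$: - *ResetEnd*: if $p_u=null\wedge end_u=True$, then $end_u:=False$. - *UpdateP*: if ($p_u=null$ and some $w\in \mathrm{matched}(N(u))$ has $p_w=u$) or $p_u\notin \mathrm{matched}(N(u))\cup\{null\}$ or ($p_u\ne null$ and $p_{p_u}\ne u$), then $p_u:=\mathrm{Lowest}\{w\in N(u):p_w=u\}$, $end_u:=False$. - *UpdateEnd*: if $p_u\in \mathrm{matched}(N(u))$,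 $p_{p_u}=u$ and $end_u\ne end_{p_u}$, then $end_u:=end_{p_u}$. Matched node $u$: - *Update*: if $\alpha_u>\beta_u$, or one of $\alpha_u,\beta_u$ is not in $\mathrm{single}(N(u))\cup\{null\}$, or $\alpha_u=\beta_u\ne null$, or $p_u\notin \mathrm{single}(N(u))\cup\{null\}$, or [$(\alpha_u,\beta_u)\ne \mathrm{BestRematch}(u)$ and ($p_u=null$ or ($p_{p_u}\ne u$ and $end_{p_u}=True$))], then $(\alpha_u,\beta_u):=\mathrm{BestRematch}(u)$ and $(p_u,s_u,end_u):=(null,False,False)$. - *MatchFirst*: let $e$ be the truth value of [$p_u=\mathrm{AskFirst}(u)$, $p_{p_u}=u$, $s_u=True$, $p_{m_u}=\mathrm{AskSecond}(m_u)$ and $end_{m_u}=True$] and $t$ that of [$p_u=\mathrm{AskFirst}(u)$, $p_{p_u}=u$ and $p_{m_u}\in\{\mathrm{AskSecond}(m_u),null\}$]. If $\mathrm{AskFirst}(u)\neq null$ and $(p_u,s_u,end_u)\ne(\mathrm{AskFirst}(u),t,e)$, then $(p_u,s_u,end_u):=(\mathrm{AskFirst}(u),t,e)$. - *MatchSecond*: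 let $e$ be the truth value of [$p_u=\mathrm{AskSecond}(u)$, $p_{p_u}=u$ and $p_{m_u}=\mathrm{AskFirst}(m_u)$]. If $\mathrm{AskSecond}(u)\ne null$, $s_{m_u}=True$ and ($p_u\neq \mathrm{AskSecond}(u)$ or $end_u\ne e$ or $s_u\ne end_u$), then $(p_u,s_u,end_u):=(\mathrm{AskSecond}(u),e,e)$. - *ResetMatch*: if [$\mathrm{AskFirst}(u)=\mathrm{AskSecond}(u)=null$ and $(p_u,s_u,end_u)\ne(null,False,False)$] or [$\mathrm{AskSecond}(u)\ne null$, $p_u\ne null$ and $s_{m_u}=False$], then $(p_u,s_u,end_u):=(null,False,False)$. A rule of $u$ is *activable* in a configuration if its guard holds and no rule of $u$ of higher priority has a true guard. In a transition, chosen by the adversarial distributed daemon, an arbitrary nonempty set of activable rules, at most one per node, is executed simultaneously; each executed rule is one *move*. A configuration is *stable* if no rule is activable in it. An execution is a finite or infinite sequence of consecutive transitions; it is *maximal* if it is infinite or ends in a stable configuration. No fairness is assumed. **Theorem.** MaxMatch converges in $O(n^3)$ moves under the adversarial distributed daemon: there is an absolute constant $c$ such that for every such $G$ and every maximal matching $\mathcal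 M$ of $G$, every maximal execution of MaxMatch, from an arbitrary initial configuration of the variables $p,\alpha,\beta,s,end$, is finite, ends in a stable configuration, and contains at most $c\,n^3$ moves in total. -/

import Mathlib

namespace MaxMatch

/-- A pointer variable: a node of the network or `null`. The value `null` is `⊤`, so it is larger
than every identifier. -/
abbrev Pointer (V : Type*) := WithTop V

/-- The local variables of a process `u`: the pointers `p_u`, `α_u`, `β_u` and the booleans
`s_u` and `end_u` (the field `fin`). Single nodes use only `p` and `fin`. -/
structure LocalState (V : Type*) where
  p : Pointer V
  α : Pointer V
  β : Pointer V
  s : Bool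
  fin : Bool

/-- A configuration: the local states of all processes. -/
abbrev Config (V : Type*) := V → LocalState V

/-- The names of the rules: three for single nodes, four for matched nodes. -/
inductive Rule where
  | resetEnd
  | updateP
  | updateEnd
  | update
  | matchFirst
  | matchSecond
  | resetMatch

/-- Priorities of the rules (1 is the strongest). Priorities are only compared between two rules of
the same node, that is between two rules for single nodes or two rules for matched nodes. -/
def Rule.priority : Rule → ℕ
  | .resetEnd => 1
  | .updateP => 2
  | .updateEnd => 3
  | .update => 1
  | .matchFirst => 2
  | .matchSecond => 3
  | .resetMatch => 4

/-- `m_u`: the node matched with `u` in `M`. Only used for matched nodes `u`; the value at a node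
without partner is irrelevant. -/
noncomputable def mate {V : Type*} {G : SimpleGraph V} (M : G.Subgraph) (u : V) : V :=
  open Classical in if h : ∃ v, M.Adj u v then h.choose else u

/-- In a matching, `mate M` is indeed the other end of the matching edge. -/
theorem mate_eq_of_adj {V : Type*} {G : SimpleGraph V} {M : G.Subgraph}
    (hM : M.IsMatching) {u v : V} (h : M.Adj u v) :
    mate M u = v := by
  have hex : ∃ v, M.Adj u v := ⟨v, h⟩
  have h1 : M.Adj u (mate M u) := by
    unfold mate
    rw [dif_pos hex]
    exact hex.choose_spec
  exact (hM (M.edge_vert h)).unique h1 h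

section Algorithm

/- The nodes are ordered by their (unique) identifiers. -/
variable {V : Type*} [Fintype V] [LinearOrder V] {G : SimpleGraph V}

/-- `Lowest(A)`: the node of `A` with the lowest identifier, `null` if `A` is empty. -/
noncomputable def lowest (A : Set V) : Pointer V :=
  open Classical in (Finset.univ.filter (fun w => w ∈ A)).min

/-- `Unique(A)`: the number of distinct nodes in the multiset `A` (`null` is not a node). -/
def unique (A : Multiset (Pointer V)) : ℕ := (A.toFinset.erase ⊤).card

/-- `A ∪ {null}` as a set of pointer values. -/
def withNull (A : Set V) : Set (Pointer V) := insert ⊤ ((fun w : V => (w : Pointer V)) '' A)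

/-- `single(N(u))`: the neighbours of `u` that are not covered by the underlying matching `M`. -/
def singleNbrs (M : G.Subgraph) (u : V) : Set V := {x | G.Adj u x ∧ x ∉ M.verts}

/-- `matched(N(u))`: the neighbours of `u` that are covered by the underlying matching `M`. -/
def matchedNbrs (M : G.Subgraph) (u : V) : Set V := {x | G.Adj u x ∧ x ∈ M.verts}

/-- `p_{p_u} = u`: the node that `u` points to exists and points back to `u`. -/
def PointedBack (C : Config V) (u : V) : Prop := ∃ w : V, (C u).p = w ∧ (C w).p = u

/-- `BestRematch(u)`, first component `a`. -/
noncomputable def bestFst (M : G.Subgraph) (C : Config V) (u : V) : Pointer V :=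
  lowest {x | x ∈ singleNbrs M u ∧ ((C x).p = u ∨ (C x).fin = false)}

/-- `BestRematch(u)`, second component `b`. -/
noncomputable def bestSnd (M : G.Subgraph) (C : Config V) (u : V) : Pointer V :=
  lowest {x | x ∈ singleNbrs M u ∧ (x : Pointer V) ≠ bestFst M C u ∧
    ((C x).p = u ∨ (C x).fin = false)}

/-- `BestRematch(u)`. -/
noncomputable def bestRematch (M : G.Subgraph) (C : Config V) (u : V) : Pointer V × Pointer V :=
  (bestFst M C u, bestSnd M C u)

/-- `AskFirst(u)`. -/
noncomputable def askFirst (M : G.Subgraph) (C : Config V) (u : V) : Pointer V :=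
  open Classical in
  if ((C u).α ≠ ⊤ ∧ (C (mate M u)).α ≠ ⊤ ∧
      2 ≤ unique {(C u).α, (C u).β, (C (mate M u)).α, (C (mate M u)).β}) ∧
    ((C u).α < (C (mate M u)).α ∨
      ((C u).α = (C (mate M u)).α ∧ (C u).β = ⊤) ∨
      ((C u).α = (C (mate M u)).α ∧ (C (mate M u)).β ≠ ⊤ ∧ u < mate M u))
  then (C u).α else ⊤

/-- `AskSecond(u)`. -/
noncomputable def askSecond (M : G.Subgraph) (C : Config V) (u : V) : Pointer V :=
  open Classical in
  if askFirst M C (mate M u) ≠ ⊤ then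
    lowest {w | ((C u).α = w ∨ (C u).β = w) ∧ (C (mate M u)).α ≠ w}
  else ⊤

/-- The condition written into `s_u` by `MatchFirst`. -/
def FirstS (M : G.Subgraph) (C : Config V) (u : V) : Prop :=
  (C u).p = askFirst M C u ∧ PointedBack C u ∧
    ((C (mate M u)).p = askSecond M C (mate M u) ∨ (C (mate M u)).p = ⊤)

/-- The condition written into `end_u` by `MatchFirst`. -/
def FirstEnd (M : G.Subgraph) (C : Config V) (u : V) : Prop :=
  (C u).p = askFirst M C u ∧ PointedBack C u ∧ (C u).s = true ∧
    (C (mate M u)).p = askSecond M C (mate M u) ∧ (C (mate M u)).fin = true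

/-- The condition written into `end_u` (and copied to `s_u`) by `MatchSecond`. -/
def SecondEnd (M : G.Subgraph) (C : Config V) (u : V) : Prop :=
  (C u).p = askSecond M C u ∧ PointedBack C u ∧ (C (mate M u)).p = askFirst M C (mate M u)

/-- The guards of the rules. -/
def Guard (M : G.Subgraph) (C : Config V) (u : V) : Rule → Prop
  | .resetEnd => u ∉ M.verts ∧ (C u).p = ⊤ ∧ (C u).fin = true
  | .updateP => u ∉ M.verts ∧
      (((C u).p = ⊤ ∧ ∃ w ∈ matchedNbrs M u, (C w).p = u) ∨
        (C u).p ∉ withNull (matchedNbrs M u) ∨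
        ((C u).p ≠ ⊤ ∧ ¬ PointedBack C u))
  | .updateEnd => u ∉ M.verts ∧
      ∃ w ∈ matchedNbrs M u, (C u).p = w ∧ (C w).p = u ∧ (C u).fin ≠ (C w).fin
  | .update => u ∈ M.verts ∧
      ((C u).β < (C u).α ∨
        ((C u).α ∉ withNull (singleNbrs M u) ∨ (C u).β ∉ withNull (singleNbrs M u)) ∨
        ((C u).α = (C u).β ∧ (C u).α ≠ ⊤) ∨
        (C u).p ∉ withNull (singleNbrs M u) ∨
        (((C u).α, (C u).β) ≠ bestRematch M C u ∧
          ((C u).p = ⊤ ∨ ∃ w : V, (C u).p = w ∧ (C w).p ≠ u ∧ (C w).fin = true)))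
  | .matchFirst => u ∈ M.verts ∧ askFirst M C u ≠ ⊤ ∧
      ((C u).p ≠ askFirst M C u ∨
        ¬ ((C u).s = true ↔ FirstS M C u) ∨
        ¬ ((C u).fin = true ↔ FirstEnd M C u))
  | .matchSecond => u ∈ M.verts ∧ askSecond M C u ≠ ⊤ ∧ (C (mate M u)).s = true ∧
      ((C u).p ≠ askSecond M C u ∨
        ¬ ((C u).fin = true ↔ SecondEnd M C u) ∨
        (C u).s ≠ (C u).fin)
  | .resetMatch => u ∈ M.verts ∧
      ((askFirst M C u = ⊤ ∧ askSecond M C u = ⊤ ∧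
          ¬ ((C u).p = ⊤ ∧ (C u).s = false ∧ (C u).fin = false)) ∨
        (askSecond M C u ≠ ⊤ ∧ (C u).p ≠ ⊤ ∧ (C (mate M u)).s = false))

/-- The commands of the rules: the new local state of `u` when it executes the rule in `C`. -/
noncomputable def command (M : G.Subgraph) (C : Config V) (u : V) : Rule → LocalState V
  | .resetEnd => { C u with fin := false }
  | .updateP => { C u with p := lowest {w | G.Adj u w ∧ (C w).p = u}, fin := false }
  | .updateEnd => { C u with fin := (C ((C u).p.untopD u)).fin }
  | .update =>
      { p := ⊤, α := (bestRematch M C u).1, β := (bestRematch M C u).2, s := false, fin := false }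
  | .matchFirst =>
      open Classical in
      { C u with fin := decide (FirstEnd M C u), s := decide (FirstS M C u), p := askFirst M C u }
  | .matchSecond =>
      open Classical in
      { C u with
        fin := decide (SecondEnd M C u), s := decide (SecondEnd M C u), p := askSecond M C u }
  | .resetMatch => { C u with p := ⊤, s := false, fin := false }

/-- Process `u` is eligible for the rule `r` in `C`: the guard holds, and no rule of `u` of
stronger priority has a true guard. -/
def Activable (M : G.Subgraph) (C : Config V) (u : V) (r : Rule) : Prop :=
  Guard M C u r ∧ ∀ r', Guard M C u r' → r.priority ≤ r'.priority

/-- A configuration is stable if no process is activable in it. -/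
def Stable (M : G.Subgraph) (C : Config V) : Prop := ∀ u r, ¬ Activable M C u r

/-- `C ↦ C'` by the action `A`: a nonempty set of activable rules, at most one for each process,
is executed simultaneously. -/
structure Transition (M : G.Subgraph) (C : Config V) (A : Finset (V × Rule)) (C' : Config V) :
    Prop where
  nonempty : A.Nonempty
  activable : ∀ a ∈ A, Activable M C a.1 a.2
  one_rule : ∀ a ∈ A, ∀ b ∈ A, a.1 = b.1 → a = b
  exec : ∀ u r, (u, r) ∈ A → C' u = command M C u r
  idle : ∀ u, (∀ r, (u, r) ∉ A) → C' u = C u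

/-- An execution `C₀, A₀, C₁, A₁, …` under the adversarial distributed daemon, with `length`
transitions (finitely or infinitely many, no fairness assumption), from an arbitrary initial
configuration. Only `config i` with `i ≤ length` and `action i` with `i < length` are meaningful. -/
structure Execution (M : G.Subgraph) where
  length : ℕ∞
  config : ℕ → Config V
  action : ℕ → Finset (V × Rule)
  step : ∀ i : ℕ, (i : ℕ∞) < length → Transition M (config i) (action i) (config (i + 1))

/-- An execution is maximal if it is infinite, or finite with a stable last configuration. -/
def Execution.IsMaximal {M : G.Subgraph} (E : Execution M) : Prop :=
  E.length = ⊤ ∨ ∃ k : ℕ, E.length = k ∧ Stable M (E.config k)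

/-- The number of moves (rules executed by single processes) in the first `k` transitions. -/
def Execution.moves {M : G.Subgraph} (E : Execution M) (k : ℕ) : ℕ :=
  ∑ i ∈ Finset.range k, (E.action i).card

end Algorithm

end MaxMatch

set_option linter.unusedSectionVars false


/-! The proof is a chain of amortised counts, each of the form "moves of one kind plus new potential
is at most old potential plus a multiple of the moves that cause them". With n nodes, the chain runs
as follows.

An announcement is a move of a matched node after which its `end` is true. Once both ends of a
matching edge are settled, which their first moves ensure, an announcement happens only when the
augmenting path through the edge is complete or completes it. A complete path never breaks again, so
each edge announces a bounded number of times (`Transition.locked`, `Transition.announce_step`) and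
there are O(n) announcements in total.

A single node sets `end` to true only by copying an announced value, and each announcement is copied
at most once (`Transition.offer_step`). As falls alternate with rises (`flips_le`), the variables
`end` of single nodes change O(n) times. The candidates of a matched node become outdated only
through such a change, and one change affects at most n nodes, so `Update` is executed O(n²) times
(`Transition.update_step`).

While neither end of a matching edge executes `Update`, its candidates are frozen and the edge makes
a bounded number of moves (`weight_step`, `Transition.edge_step`). Finally, `UpdateP` is charged to
matched nodes turning to or away from a single node, and every other move of a single node changes
its `end`.

A suitable linear combination of the potentials therefore drops by at least the number of moves in
every transition (`Transition.card_add_potential_le`). Its initial value is in fact O(n²), which is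
stronger than needed. -/

namespace MaxMatch

/-- The indicator of a proposition, as a natural number. -/
noncomputable def ind (p : Prop) : ℕ := open Classical in if p then 1 else 0

theorem ind_le_one (p : Prop) : ind p ≤ 1 := by unfold ind; split_ifs <;> simp

theorem ind_true {p : Prop} (h : p) : ind p = 1 := by simp [ind, h]

theorem ind_false {p : Prop} (h : ¬ p) : ind p = 0 := by simp [ind, h]

theorem ind_mono {p q : Prop} (h : p → q) : ind p ≤ ind q := by
  by_cases hp : p
  · rw [ind_true hp, ind_true (h hp)]
  · rw [ind_false hp]; exact Nat.zero_le _

theorem ind_congr {p q : Prop} (h : p ↔ q) : ind p = ind q := by rw [propext h]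

theorem ind_le_sum {ι : Type*} (s : Finset ι) (f : ι → Prop) {p : Prop}
    (h : p → ∃ i ∈ s, f i) : ind p ≤ ∑ i ∈ s, ind (f i) := by
  by_cases hp : p
  · obtain ⟨i, hi, hf⟩ := h hp
    calc ind p ≤ 1 := ind_le_one _
      _ = ind (f i) := (ind_true hf).symm
      _ ≤ _ := Finset.single_le_sum (f := fun i => ind (f i)) (fun _ _ => Nat.zero_le _) hi
  · rw [ind_false hp]; exact Nat.zero_le _

theorem sum_ind_le_ind {ι : Type*} (s : Finset ι) (f : ι → Prop)
    (h : ∀ i j, f i → f j → i = j) : ∑ i ∈ s, ind (f i) ≤ ind (∃ i, f i) := by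
  by_cases hp : ∃ i, f i
  · obtain ⟨i, hi⟩ := hp
    rw [ind_true ⟨i, hi⟩]
    by_cases his : i ∈ s
    · rw [Finset.sum_eq_single_of_mem i his
        (fun j _ hji => ind_false (fun hj => hji (h _ _ hj hi)))]
      exact ind_le_one _
    · rw [Finset.sum_eq_zero (fun j hj => ind_false (fun hfj => his (h _ _ hfj hi ▸ hj)))]
      exact Nat.zero_le _
  · rw [Finset.sum_eq_zero (fun j _ => ind_false (fun hj => hp ⟨j, hj⟩))]
    exact Nat.zero_le _

/-! ### Partners in the matching, and maximality. -/

section Mate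

variable {V : Type*} {G : SimpleGraph V} {M : G.Subgraph}

theorem adj_mate (hM : M.IsMatching) {u : V} (hu : u ∈ M.verts) : M.Adj u (mate M u) := by
  obtain ⟨v, hv, -⟩ := hM hu
  rw [mate_eq_of_adj hM hv]; exact hv

theorem mate_mem (hM : M.IsMatching) {u : V} (hu : u ∈ M.verts) : mate M u ∈ M.verts :=
  (adj_mate hM hu).snd_mem

theorem mate_mate (hM : M.IsMatching) {u : V} (hu : u ∈ M.verts) : mate M (mate M u) = u :=
  mate_eq_of_adj hM (adj_mate hM hu).symm

/-- The uncovered nodes of a maximal matching form an independent set. -/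
theorem mem_verts_of_adj (hM : Maximal SimpleGraph.Subgraph.IsMatching M) {x y : V}
    (hx : x ∉ M.verts) (h : G.Adj x y) : y ∈ M.verts := by
  by_contra hy
  have hdis : Disjoint M.support (G.subgraphOfAdj h).support := by
    rw [hM.1.support_eq_verts, SimpleGraph.support_subgraphOfAdj, Set.disjoint_right]
    rintro z (rfl | rfl) <;> assumption
  -- If both ends were uncovered, adding the edge would give a strictly larger matching.
  have h2 := hM.1.sup (SimpleGraph.Subgraph.IsMatching.subgraphOfAdj h) hdis
  have h3 := hM.2 h2 le_sup_left
  exact hx (h3.1 (by simp))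

end Mate

/-! ### Pointers, asks, and the effect of one transition on one node. -/

section Basic

variable {V : Type*} [Fintype V] [LinearOrder V] {G : SimpleGraph V} {M : G.Subgraph}
  {C C' : Config V} {A : Finset (V × Rule)} {u v x w : V}

theorem mem_of_lowest {S : Set V} (h : lowest S = (w : Pointer V)) : w ∈ S := by
  classical
  have := Finset.mem_of_min h
  simpa using this

theorem lowest_le {S : Set V} (h : w ∈ S) : lowest S ≤ (w : Pointer V) := by
  classical
  exact Finset.min_le (by simpa using h)

theorem lowest_ne_top {S : Set V} (h : w ∈ S) : lowest S ≠ ⊤ := by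
  intro h'
  have := lowest_le h
  rw [h'] at this
  exact absurd (top_le_iff.1 this) (WithTop.coe_ne_top)

theorem lowest_anti {S S' : Set V} (h : S ⊆ S') : lowest S' ≤ lowest S := by
  rcases hS : lowest S with _ | w
  · exact le_top
  · exact lowest_le (h (mem_of_lowest hS))

theorem mem_withNull {S : Set V} {p : Pointer V} :
    p ∈ withNull S ↔ p = ⊤ ∨ ∃ w ∈ S, p = (w : Pointer V) := by
  simp [withNull, eq_comm]

theorem lowest_mem_withNull {S S' : Set V} (h : S ⊆ S') : lowest S ∈ withNull S' := by
  rw [mem_withNull]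
  rcases hS : lowest S with _ | w
  · exact Or.inl rfl
  · exact Or.inr ⟨w, h (mem_of_lowest hS), rfl⟩

theorem bestFst_le_bestSnd : bestFst M C u ≤ bestSnd M C u :=
  lowest_anti (fun _ h => ⟨h.1, h.2.2⟩)

theorem bestFst_mem : bestFst M C u ∈ withNull (singleNbrs M u) :=
  lowest_mem_withNull (fun _ h => h.1)

theorem bestSnd_mem : bestSnd M C u ∈ withNull (singleNbrs M u) :=
  lowest_mem_withNull (fun _ h => h.1)

theorem bestFst_eq_top_of_eq (h : bestFst M C u = bestSnd M C u) : bestFst M C u = ⊤ := by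
  rcases hS : bestSnd M C u with _ | w
  · rw [h, hS]; rfl
  · have := mem_of_lowest hS
    exact absurd (by rw [h, hS]; rfl) this.2.1

/-- The pointers of a matched node have the shape that `Update` establishes. -/
def WellFormed (M : G.Subgraph) (C : Config V) (u : V) : Prop :=
  (C u).α ≤ (C u).β ∧ (C u).α ∈ withNull (singleNbrs M u) ∧
    (C u).β ∈ withNull (singleNbrs M u) ∧ ((C u).α = (C u).β → (C u).α = ⊤) ∧
    (C u).p ∈ withNull (singleNbrs M u)

theorem guard_update_iff : Guard M C u .update ↔ u ∈ M.verts ∧ (¬ WellFormed M C u ∨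
    (((C u).α, (C u).β) ≠ bestRematch M C u ∧
      ((C u).p = ⊤ ∨ ∃ w : V, (C u).p = w ∧ (C w).p ≠ u ∧ (C w).fin = true))) := by
  simp only [Guard, WellFormed, ← not_le]
  tauto

/-- Process `u` points to a single neighbour that points back to it. -/
def Engaged (M : G.Subgraph) (C : Config V) (u : V) : Prop :=
  ∃ x ∈ singleNbrs M u, (C u).p = (x : Pointer V) ∧ (C x).p = (u : Pointer V)

theorem Engaged.pointedBack (h : Engaged M C u) : PointedBack C u := by
  obtain ⟨x, -, h1, h2⟩ := h; exact ⟨x, h1, h2⟩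

theorem Engaged.p_ne_top (h : Engaged M C u) : (C u).p ≠ ⊤ := by
  obtain ⟨x, -, h1, -⟩ := h; rw [h1]; exact WithTop.coe_ne_top

theorem engaged_of_pointedBack (hw : (C u).p ∈ withNull (singleNbrs M u))
    (h : PointedBack C u) : Engaged M C u := by
  obtain ⟨x, h1, h2⟩ := h
  rcases mem_withNull.1 hw with h3 | ⟨y, hy, h3⟩
  · rw [h1] at h3; exact absurd h3 WithTop.coe_ne_top
  · rw [h1] at h3
    obtain rfl := WithTop.coe_injective h3
    exact ⟨x, hy, h1, h2⟩

/-- A well-formed node can only be updated while its pointer is null or its target points elsewhere.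
Mutual pointing thus protects the candidates of the node. -/
theorem not_guard_update (hw : WellFormed M C u) (h : Engaged M C u) :
    ¬ Guard M C u .update := by
  obtain ⟨x, -, h1, h2⟩ := h
  rw [guard_update_iff]
  rintro ⟨-, h3 | ⟨-, h3 | ⟨w, h3, h4, -⟩⟩⟩
  · exact h3 hw
  · rw [h1] at h3; exact WithTop.coe_ne_top h3
  · rw [h1] at h3
    obtain rfl := WithTop.coe_injective h3
    exact h4 h2

theorem WellFormed.congr (h : WellFormed M C u) (hα : (C' u).α = (C u).α)
    (hβ : (C' u).β = (C u).β) (hp : (C' u).p ∈ withNull (singleNbrs M u)) :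
    WellFormed M C' u := by
  unfold WellFormed
  rw [hα, hβ]
  exact ⟨h.1, h.2.1, h.2.2.1, h.2.2.2.1, hp⟩

theorem WellFormed.of_eq (h : WellFormed M C u) (h' : C' u = C u) : WellFormed M C' u := by
  unfold WellFormed; rw [h']; exact h

theorem askFirst_eq (h : askFirst M C u ≠ ⊤) : askFirst M C u = (C u).α := by
  unfold askFirst at h ⊢
  split_ifs with h'
  · rfl
  · rw [if_neg h'] at h; exact absurd rfl h

/-- The three alternatives in `askFirst` break the symmetry between the two ends: by the first
candidates, then by a missing second candidate, then by identifiers. -/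
theorem askFirst_mate (hM : M.IsMatching) (hu : u ∈ M.verts) (h : askFirst M C u ≠ ⊤) :
    askFirst M C (mate M u) = ⊤ := by
  by_contra h'
  change _ ≠ _ at h'
  unfold askFirst at h h'
  rw [ite_ne_right_iff] at h h'
  rw [mate_mate hM hu] at h'
  obtain ⟨⟨⟨-, -, h1⟩, h2⟩, -⟩ := h
  obtain ⟨⟨-, h3⟩, -⟩ := h'
  -- With equal first candidates and both second candidates null there is only one distinct node,
  -- against the requirement of two.
  have key : (C u).α = (C (mate M u)).α → (C u).β = ⊤ → (C (mate M u)).β ≠ ⊤ := by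
    intro h2 h5 h6
    rw [← h2, h5, h6] at h1
    have h7 : unique {(C u).α, ⊤, (C u).α, ⊤} ≤ 1 := by
      refine Finset.card_le_one.2 ?_
      simp only [Finset.mem_erase, Multiset.mem_toFinset, Multiset.insert_eq_cons,
        Multiset.mem_cons, Multiset.mem_singleton]
      rintro a ⟨ha, ha'⟩ b ⟨hb, hb'⟩
      rcases ha' with h | h | h | h <;> rcases hb' with h' | h' | h' | h' <;>
        first
        | exact absurd h ha
        | exact absurd h' hb
        | exact h.trans h'.symm
    omega
  rcases h2 with h2 | ⟨h2, h4⟩ | ⟨h2, h4, h5⟩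
  · rcases h3 with h3 | ⟨h3, -⟩ | ⟨h3, -⟩
    · exact lt_asymm h2 h3
    · exact h2.ne h3.symm
    · exact h2.ne h3.symm
  · have h5 := key h2 h4
    rcases h3 with h3 | ⟨-, h3⟩ | ⟨-, h3, -⟩
    · exact h3.ne h2.symm
    · exact h5 h3
    · exact h3 h4
  · rcases h3 with h3 | ⟨-, h3⟩ | ⟨-, -, h3⟩
    · exact h3.ne h2.symm
    · exact h4 h3
    · exact lt_asymm h5 h3

theorem askSecond_ne_top (h : askSecond M C u ≠ ⊤) : askFirst M C (mate M u) ≠ ⊤ := by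
  unfold askSecond at h
  split_ifs at h with h'
  · exact h'
  · exact absurd rfl h

theorem askSecond_eq (h : askSecond M C u ≠ ⊤) :
    askSecond M C u = (C u).α ∨ askSecond M C u = (C u).β := by
  have h' := askSecond_ne_top h
  unfold askSecond at h ⊢
  rw [if_pos h'] at h ⊢
  obtain ⟨w, hw⟩ := WithTop.ne_top_iff_exists.1 h
  rw [← hw]
  rcases (mem_of_lowest hw.symm).1 with h1 | h1 <;> simp [h1]

theorem askFirst_of_askSecond (hM : M.IsMatching) (hu : u ∈ M.verts)
    (h : askSecond M C u ≠ ⊤) : askFirst M C u = ⊤ := by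
  have := askFirst_mate hM (mate_mem hM hu) (askSecond_ne_top h)
  rwa [mate_mate hM hu] at this

theorem askSecond_of_askFirst (hM : M.IsMatching) (hu : u ∈ M.verts)
    (h : askFirst M C u ≠ ⊤) : askSecond M C u = ⊤ := by
  by_contra h'
  exact h (askFirst_of_askSecond hM hu h')

theorem askFirst_congr (hα : (C' u).α = (C u).α) (hβ : (C' u).β = (C u).β)
    (hα' : (C' (mate M u)).α = (C (mate M u)).α) (hβ' : (C' (mate M u)).β = (C (mate M u)).β) :
    askFirst M C' u = askFirst M C u := by
  unfold askFirst
  rw [hα, hβ, hα', hβ']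

theorem askSecond_congr (hM : M.IsMatching) (hu : u ∈ M.verts)
    (hα : (C' u).α = (C u).α) (hβ : (C' u).β = (C u).β)
    (hα' : (C' (mate M u)).α = (C (mate M u)).α) (hβ' : (C' (mate M u)).β = (C (mate M u)).β) :
    askSecond M C' u = askSecond M C u := by
  unfold askSecond
  rw [askFirst_congr hα' hβ' (by rwa [mate_mate hM hu]) (by rwa [mate_mate hM hu]), hα, hβ, hα']

theorem WellFormed.askFirst_mem (h : WellFormed M C u) :
    askFirst M C u ∈ withNull (singleNbrs M u) := by
  by_cases h' : askFirst M C u = ⊤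
  · exact mem_withNull.2 (Or.inl h')
  · rw [askFirst_eq h']; exact h.2.1

theorem WellFormed.askSecond_mem (h : WellFormed M C u) :
    askSecond M C u ∈ withNull (singleNbrs M u) := by
  by_cases h' : askSecond M C u = ⊤
  · exact mem_withNull.2 (Or.inl h')
  · rcases askSecond_eq h' with h1 | h1 <;> rw [h1]
    exacts [h.2.1, h.2.2.1]

/-- Process `u` executes a rule in the action `A`. -/
def Moves (A : Finset (V × Rule)) (u : V) : Prop := ∃ r, (u, r) ∈ A

theorem Transition.idle' (T : Transition M C A C') (h : ¬ Moves A u) : C' u = C u :=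
  T.idle u (fun r hr => h ⟨r, hr⟩)

/-- `Update` has the highest priority, so any other rule of a matched node runs only where the guard
of `Update` fails, and there the node is well formed. -/
theorem Transition.cases_matched (T : Transition M C A C') (hu : u ∈ M.verts) :
    (¬ Moves A u ∧ (u, .update) ∉ A ∧ C' u = C u) ∨
    (Moves A u ∧ (u, .update) ∈ A ∧ Guard M C u .update ∧ C' u = command M C u .update) ∨
    (Moves A u ∧ (u, .update) ∉ A ∧ ¬ Guard M C u .update ∧ WellFormed M C u ∧
      ((Guard M C u .matchFirst ∧ C' u = command M C u .matchFirst) ∨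
       (Guard M C u .matchSecond ∧ C' u = command M C u .matchSecond) ∨
       (Guard M C u .resetMatch ∧ C' u = command M C u .resetMatch))) := by
  by_cases hm : Moves A u
  · right
    obtain ⟨r, hr⟩ := hm
    have hact := T.activable _ hr
    have hex := T.exec _ _ hr
    have hwf : ¬ Guard M C u .update → WellFormed M C u := by
      rw [guard_update_iff]; tauto
    have key : 1 < r.priority → (u, .update) ∉ A ∧ ¬ Guard M C u .update ∧ WellFormed M C u := by
      intro h1
      have h2 : ¬ Guard M C u .update := fun h => absurd (hact.2 _ h) (by simpa [Rule.priority])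
      refine ⟨fun h => h2 (T.activable _ h).1, h2, hwf h2⟩
    cases r with
    | resetEnd => exact absurd hu hact.1.1
    | updateP => exact absurd hu hact.1.1
    | updateEnd => exact absurd hu hact.1.1
    | update => exact Or.inl ⟨⟨_, hr⟩, hr, hact.1, hex⟩
    | matchFirst =>
      obtain ⟨h1, h2, h3⟩ := key (by simp [Rule.priority])
      exact Or.inr ⟨⟨_, hr⟩, h1, h2, h3, Or.inl ⟨hact.1, hex⟩⟩
    | matchSecond =>
      obtain ⟨h1, h2, h3⟩ := key (by simp [Rule.priority])
      exact Or.inr ⟨⟨_, hr⟩, h1, h2, h3, Or.inr (Or.inl ⟨hact.1, hex⟩)⟩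
    | resetMatch =>
      obtain ⟨h1, h2, h3⟩ := key (by simp [Rule.priority])
      exact Or.inr ⟨⟨_, hr⟩, h1, h2, h3, Or.inr (Or.inr ⟨hact.1, hex⟩)⟩
  · exact Or.inl ⟨hm, fun h => hm ⟨_, h⟩, T.idle' hm⟩

theorem Transition.cases_single (T : Transition M C A C') (hx : x ∉ M.verts) :
    (¬ Moves A x ∧ (x, .updateP) ∉ A ∧ C' x = C x) ∨
    ((x, .updateP) ∉ A ∧ (C x).p = ⊤ ∧ (C x).fin = true ∧ (C' x).p = (C x).p ∧
      (C' x).fin = false) ∨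
    ((x, .updateP) ∈ A ∧ Guard M C x .updateP ∧ (C' x).fin = false ∧
      (C' x).p = lowest {w | G.Adj x w ∧ (C w).p = x}) ∨
    ((x, .updateP) ∉ A ∧ ∃ w ∈ matchedNbrs M x, (C x).p = w ∧ (C w).p = x ∧
      (C x).fin ≠ (C w).fin ∧ (C' x).p = (C x).p ∧ (C' x).fin = (C w).fin) := by
  by_cases hm : Moves A x
  · right
    obtain ⟨r, hr⟩ := hm
    have hact := T.activable _ hr
    have hex := T.exec _ _ hr
    have key : (x, .updateP) ∈ A → r = .updateP := fun h =>
      congrArg Prod.snd (T.one_rule _ hr _ h rfl)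
    cases r with
    | resetEnd =>
      refine Or.inl ⟨fun h => by simpa using key h, hact.1.2.1, hact.1.2.2, ?_, ?_⟩ <;>
        simp [hex, command]
    | updateP =>
      refine Or.inr (Or.inl ⟨hr, hact.1, ?_, ?_⟩) <;> simp [hex, command]
    | updateEnd =>
      obtain ⟨-, w, hw, h1, h2, h3⟩ := hact.1
      refine Or.inr (Or.inr ⟨fun h => by simpa using key h, w, hw, h1, h2, h3, ?_, ?_⟩)
      · simp [hex, command]
      · simp only at h1
        simp [hex, command, h1]
    | update => exact absurd hact.1.1 hx
    | matchFirst => exact absurd hact.1.1 hx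
    | matchSecond => exact absurd hact.1.1 hx
    | resetMatch => exact absurd hact.1.1 hx
  · exact Or.inl ⟨hm, fun h => hm ⟨_, h⟩, T.idle' hm⟩

/-- The guard of `UpdateP` fails for a single node in a mutual pair, and the other rules of single
nodes leave the pointer alone. Hence only the matched side can break the pair. -/
theorem Transition.engaged (T : Transition M C A C') (hu : u ∈ M.verts) (h : Engaged M C u)
    (hp : (C' u).p = (C u).p) : Engaged M C' u := by
  obtain ⟨x, hx, h1, h2⟩ := h
  refine ⟨x, hx, by rw [hp, h1], ?_⟩
  rcases T.cases_single hx.2 with ⟨-, -, h⟩ | ⟨-, -, -, h, -⟩ | ⟨-, h, -⟩ | ⟨-, w, -, -, -, -, h, -⟩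
  · rw [h, h2]
  · rw [h, h2]
  · exfalso
    rcases h.2 with h | h | h
    · rw [h2] at h; exact WithTop.coe_ne_top h.1
    · exact h (mem_withNull.2 (Or.inr ⟨u, ⟨hx.1.symm, hu⟩, h2⟩))
    · exact h.2 ⟨u, h2, h1⟩
  · rw [h, h2]

theorem Transition.wellFormed (T : Transition M C A C') (hu : u ∈ M.verts)
    (h : WellFormed M C u ∨ Moves A u) : WellFormed M C' u := by
  rcases T.cases_matched hu with ⟨h1, -, h2⟩ | ⟨-, -, -, h2⟩ | ⟨-, -, -, hw, h2⟩
  · exact (h.resolve_right h1).of_eq h2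
  · unfold WellFormed
    rw [h2]
    exact ⟨bestFst_le_bestSnd, bestFst_mem, bestSnd_mem, bestFst_eq_top_of_eq,
      mem_withNull.2 (Or.inl rfl)⟩
  · rcases h2 with ⟨-, h2⟩ | ⟨-, h2⟩ | ⟨-, h2⟩ <;>
      refine hw.congr (by rw [h2]; rfl) (by rw [h2]; rfl) ?_ <;> rw [h2]
    · exact hw.askFirst_mem
    · exact hw.askSecond_mem
    · exact mem_withNull.2 (Or.inl rfl)

theorem Transition.candidates (T : Transition M C A C') (hu : u ∈ M.verts)
    (h : (u, .update) ∉ A) : (C' u).α = (C u).α ∧ (C' u).β = (C u).β := by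
  rcases T.cases_matched hu with ⟨-, -, h2⟩ | ⟨-, h2, -, -⟩ | ⟨-, -, -, -, h2⟩
  · simp [h2]
  · exact absurd h2 h
  · rcases h2 with ⟨-, h2⟩ | ⟨-, h2⟩ | ⟨-, h2⟩ <;> simp [h2, command]

/-- Both asks depend only on the candidates of the two ends, and these are written by `Update`
alone. -/
theorem Transition.asks (hM : M.IsMatching) (T : Transition M C A C') (hu : u ∈ M.verts)
    (h : (u, .update) ∉ A) (h' : (mate M u, .update) ∉ A) :
    askFirst M C' u = askFirst M C u ∧ askSecond M C' u = askSecond M C u := by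
  obtain ⟨h1, h2⟩ := T.candidates hu h
  obtain ⟨h3, h4⟩ := T.candidates (mate_mem hM hu) h'
  exact ⟨askFirst_congr h1 h2 h3 h4, askSecond_congr hM hu h1 h2 h3 h4⟩

end Basic

end MaxMatch

namespace MaxMatch

/-! ### Moves of single nodes, executions of `Update`, and their causes. -/

section Singles

variable {V : Type*} [Fintype V] [LinearOrder V] {G : SimpleGraph V} {M : G.Subgraph}
  {C C' : Config V} {A : Finset (V × Rule)} {u v x w : V}

/-- The nodes covered by the underlying matching. -/
noncomputable def covered (M : G.Subgraph) : Finset V :=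
  open Classical in Finset.univ.filter (fun u => u ∈ M.verts)

/-- The nodes not covered by the underlying matching. -/
noncomputable def uncovered (M : G.Subgraph) : Finset V :=
  open Classical in Finset.univ.filter (fun u => u ∉ M.verts)

theorem mem_covered : u ∈ covered M ↔ u ∈ M.verts := by simp [covered]

theorem mem_uncovered : u ∈ uncovered M ↔ u ∉ M.verts := by simp [uncovered]

theorem sum_covered_add_sum_uncovered (f : V → ℕ) :
    ∑ u ∈ covered M, f u + ∑ u ∈ uncovered M, f u = ∑ u, f u := by
  classical
  unfold covered uncovered
  convert Finset.sum_filter_add_sum_filter_not Finset.univ (fun u => u ∈ M.verts) f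

theorem Transition.card_eq (T : Transition M C A C') : A.card = ∑ u, ind (Moves A u) := by
  classical
  have h1 : (A.image Prod.fst).card = A.card :=
    Finset.card_image_of_injOn (fun a ha b hb h => T.one_rule a ha b hb h)
  rw [← h1, Finset.card_eq_sum_ones, ← Finset.sum_filter_add_sum_filter_not Finset.univ
    (fun u => u ∈ A.image Prod.fst) (fun u => ind (Moves A u))]
  rw [Finset.sum_eq_zero (s := Finset.univ.filter (fun u => u ∉ A.image Prod.fst)), add_zero]
  · rw [Finset.filter_mem_eq_inter, Finset.univ_inter]
    refine Finset.sum_congr rfl (fun u hu => (ind_true ?_).symm)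
    obtain ⟨⟨w, r⟩, ha, rfl⟩ := Finset.mem_image.1 hu
    exact ⟨r, ha⟩
  · intro u hu
    refine ind_false ?_
    rintro ⟨r, hr⟩
    exact (Finset.mem_filter.1 hu).2 (Finset.mem_image.2 ⟨_, hr, rfl⟩)

/-- The pointer of a single node changes only to or from a matched node that moves. -/
theorem Transition.updateP_step (hM : Maximal SimpleGraph.Subgraph.IsMatching M)
    (T : Transition M C A C') (hx : x ∉ M.verts) :
    ind ((x, .updateP) ∈ A) + ind (Guard M C' x .updateP) ≤ ind (Guard M C x .updateP) +
      ∑ w ∈ covered M, (ind (Moves A w ∧ (C w).p = x) + ind (Moves A w ∧ (C' w).p = x)) := by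
  have hsum : (∃ w ∈ M.verts, Moves A w ∧ ((C w).p = x ∨ (C' w).p = x)) →
      1 ≤ ∑ w ∈ covered M,
        (ind (Moves A w ∧ (C w).p = x) + ind (Moves A w ∧ (C' w).p = x)) := by
    rintro ⟨w, hw, h1, h2⟩
    refine le_trans ?_ (Finset.single_le_sum (f := fun w => ind (Moves A w ∧ (C w).p = x) +
      ind (Moves A w ∧ (C' w).p = x)) (fun _ _ => Nat.zero_le _) (mem_covered.2 hw))
    rcases h2 with h2 | h2
    · simp only [ind_true (show Moves A w ∧ (C w).p = x from ⟨h1, h2⟩)]; omega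
    · simp only [ind_true (show Moves A w ∧ (C' w).p = x from ⟨h1, h2⟩)]; omega
  -- `UpdateP` selects among all neighbours, but its guard accepts only matched ones. Maximality
  -- makes the two agree.
  have hcov : ∀ w, G.Adj x w → w ∈ M.verts := fun w => mem_verts_of_adj hM hx
  have hmv : ∀ w, (C' w).p ≠ (C w).p → Moves A w := by
    intro w h
    by_contra h'
    exact h (by rw [T.idle' h'])
  -- If some moving matched node pointed at `x` before or points at it afterwards, the sum pays for
  -- a guard that holds after the transition.
  by_cases hmoved : ∃ w ∈ M.verts, Moves A w ∧ ((C w).p = x ∨ (C' w).p = x)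
  · have h1 := hsum hmoved
    have h2 : (x, Rule.updateP) ∈ A → Guard M C x .updateP := fun h => (T.activable _ h).1
    have h3 := ind_mono h2
    have h4 := ind_le_one (Guard M C' x .updateP)
    omega
  · -- nobody turns towards or away from `x`
    have hsame : ∀ w ∈ M.verts, (C' w).p = x ↔ (C w).p = x := by
      intro w hw
      by_cases h : (C' w).p = (C w).p
      · rw [h]
      · constructor <;> intro h' <;> exact absurd ⟨w, hw, hmv w h, by tauto⟩ hmoved
    by_cases hA : (x, Rule.updateP) ∈ A
    · have h1 := ind_true (T.activable _ hA).1
      have h2 : ¬ Guard M C' x .updateP := by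
        have hp : (C' x).p = lowest {w | G.Adj x w ∧ (C w).p = x} := by
          rw [T.exec _ _ hA]; rfl
        rcases hl : (C' x).p with _ | w
        · rintro ⟨-, ⟨-, w, hw, h⟩ | h | h⟩
          · refine lowest_ne_top (S := {w | G.Adj x w ∧ (C w).p = x})
              (w := w) ⟨hw.1, (hsame w hw.2).1 h⟩ ?_
            rw [← hp, hl]; rfl
          · exact h (mem_withNull.2 (Or.inl hl))
          · exact h.1 hl
        · rw [hp] at hl
          have hw := mem_of_lowest hl
          rw [← hp] at hl
          have hwv := hcov w hw.1
          rintro ⟨-, ⟨h, -⟩ | h | h⟩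
          · rw [hl] at h; exact WithTop.coe_ne_top h
          · exact h (mem_withNull.2 (Or.inr ⟨w, ⟨hw.1, hwv⟩, hl⟩))
          · exact h.2 ⟨w, hl, (hsame w hwv).2 hw.2⟩
      have h3 := ind_le_one ((x, Rule.updateP) ∈ A)
      rw [ind_false h2, h1]; simp only at *; omega
    · have hp : (C' x).p = (C x).p := by
        rcases T.cases_single hx with ⟨-, -, h⟩ | ⟨-, -, -, h, -⟩ | ⟨h, -⟩ | ⟨-, w, -, -, -, -, h, -⟩
        · rw [h]
        · exact h
        · exact absurd h hA
        · exact h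
      have h2 : Guard M C' x .updateP → Guard M C x .updateP := by
        rintro ⟨-, ⟨h, w, hw, h'⟩ | h | h⟩
        · exact ⟨hx, Or.inl ⟨hp ▸ h, w, hw, (hsame w hw.2).1 h'⟩⟩
        · exact ⟨hx, Or.inr (Or.inl (hp ▸ h))⟩
        · by_cases h3 : (C x).p ∈ withNull (matchedNbrs M x)
          · refine ⟨hx, Or.inr (Or.inr ⟨hp ▸ h.1, ?_⟩)⟩
            rintro ⟨w, h4, h5⟩
            rcases mem_withNull.1 h3 with h6 | ⟨w', hw', h6⟩
            · rw [h4] at h6; exact WithTop.coe_ne_top h6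
            · rw [h4] at h6
              obtain rfl := WithTop.coe_injective h6
              exact h.2 ⟨w, hp.trans h4, (hsame w hw'.2).2 h5⟩
          · exact ⟨hx, Or.inr (Or.inl h3)⟩
      rw [ind_false hA]
      have := ind_mono h2
      omega

/-- The number of moves of matched nodes. -/
noncomputable def matchedMoves (M : G.Subgraph) (A : Finset (V × Rule)) : ℕ :=
  ∑ w ∈ covered M, ind (Moves A w)

/-- The number of executions of `UpdateP`. -/
noncomputable def updatePMoves (M : G.Subgraph) (A : Finset (V × Rule)) : ℕ :=
  ∑ x ∈ uncovered M, ind ((x, .updateP) ∈ A)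

/-- The number of single nodes that are ready for `UpdateP`. -/
noncomputable def updatePPot (M : G.Subgraph) (C : Config V) : ℕ :=
  ∑ x ∈ uncovered M, ind (Guard M C x .updateP)

/-- The factor 2 arises because a moving matched node has at most one old and one new target. -/
theorem Transition.updatePMoves_le (hM : Maximal SimpleGraph.Subgraph.IsMatching M)
    (T : Transition M C A C') :
    updatePMoves M A + updatePPot M C' ≤ updatePPot M C + 2 * matchedMoves M A := by
  have h1 := Finset.sum_le_sum (fun x (hx : x ∈ uncovered M) =>
    T.updateP_step hM (mem_uncovered.1 hx))
  rw [Finset.sum_add_distrib, Finset.sum_add_distrib] at h1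
  refine h1.trans (Nat.add_le_add_left ?_ _)
  rw [Finset.sum_comm, matchedMoves, Finset.mul_sum]
  refine Finset.sum_le_sum (fun w _ => ?_)
  rw [Finset.sum_add_distrib, two_mul]
  refine add_le_add ?_ ?_ <;>
  · refine (sum_ind_le_ind _ _ ?_).trans (ind_mono (fun ⟨_, h⟩ => h.1))
    rintro i j ⟨-, hi⟩ ⟨-, hj⟩
    exact WithTop.coe_injective (hi.symm.trans hj)

/-- The number of single nodes whose variable `end` changes. -/
noncomputable def flips (M : G.Subgraph) (C C' : Config V) : ℕ :=
  ∑ x ∈ uncovered M, ind ((C' x).fin ≠ (C x).fin)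

/-- The number of single nodes whose variable `end` becomes true. -/
noncomputable def rises (M : G.Subgraph) (C C' : Config V) : ℕ :=
  ∑ x ∈ uncovered M, ind ((C x).fin = false ∧ (C' x).fin = true)

/-- The number of single nodes whose variable `end` is true. -/
noncomputable def finPot (M : G.Subgraph) (C : Config V) : ℕ :=
  ∑ x ∈ uncovered M, ind ((C x).fin = true)

/-- Between two falls of the same variable there is a rise, so only falls of initially true
variables remain unpaid. -/
theorem flips_le (M : G.Subgraph) (C C' : Config V) :
    flips M C C' + finPot M C' ≤ finPot M C + 2 * rises M C C' := by
  unfold flips finPot rises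
  rw [Finset.mul_sum, ← Finset.sum_add_distrib, ← Finset.sum_add_distrib]
  refine Finset.sum_le_sum (fun x _ => ?_)
  cases h : (C x).fin <;> cases h' : (C' x).fin <;> simp [ind]

theorem Transition.uncovered_moves_le (T : Transition M C A C') :
    ∑ x ∈ uncovered M, ind (Moves A x) ≤ updatePMoves M A + flips M C C' := by
  unfold updatePMoves flips
  rw [← Finset.sum_add_distrib]
  refine Finset.sum_le_sum (fun x hx => ?_)
  have hle := ind_le_one (Moves A x)
  rcases T.cases_single (mem_uncovered.1 hx) with ⟨h, -⟩ | ⟨-, -, h1, -, h2⟩ | ⟨h, -⟩ |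
      ⟨-, w, -, -, -, h1, -, h2⟩
  · rw [ind_false h]; exact Nat.zero_le _
  · rw [ind_true (show (C' x).fin ≠ (C x).fin by rw [h1, h2]; simp)]; omega
  · rw [ind_true h]; omega
  · rw [ind_true (show (C' x).fin ≠ (C x).fin by rw [h2]; exact h1.symm)]; omega

/-- The candidates of all matched nodes are the same as long as no single node changes `end`. -/
theorem Transition.bestRematch_eq (T : Transition M C A C')
    (h : ∀ x ∉ M.verts, (C' x).fin = (C x).fin) : bestRematch M C' u = bestRematch M C u := by
  have key : ∀ x ∈ singleNbrs M u, (((C' x).p = u ∨ (C' x).fin = false) ↔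
      ((C x).p = u ∨ (C x).fin = false)) := by
    intro x hx
    have h1 := h x hx.2
    rcases T.cases_single hx.2 with ⟨-, -, h2⟩ | ⟨-, -, -, h2, -⟩ | ⟨-, -, h2, -⟩ |
      ⟨-, w, -, -, -, -, h2, -⟩
    · rw [h2]
    · rw [h1, h2]
    -- `UpdateP` may change the pointer, but it leaves `end` false. As `end` did not change, it was
    -- false before, so `x` is a candidate in both configurations.
    · rw [← h1, h2]; simp
    · rw [h1, h2]
  have h1 : bestFst M C' u = bestFst M C u := by
    unfold bestFst
    congr 1; ext x
    exact and_congr_right (fun hx => key x hx)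
  unfold bestRematch
  rw [h1]
  congr 1
  unfold bestSnd
  rw [h1]
  congr 1; ext x
  exact and_congr_right (fun hx => and_congr_right (fun _ => key x hx))

/-- A process is up to date if it is well formed with the best candidates. -/
def UpToDate (M : G.Subgraph) (C : Config V) (u : V) : Prop :=
  WellFormed M C u ∧ ((C u).α, (C u).β) = bestRematch M C u

/-- An execution of `Update` starts from an outdated node and, if no single node flips `end`, leaves
it up to date. A flip pays for the node being outdated afterwards. -/
theorem Transition.update_step (T : Transition M C A C') (hu : u ∈ M.verts) :
    ind ((u, .update) ∈ A) + ind (¬ UpToDate M C' u) ≤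
      ind (¬ UpToDate M C u) + flips M C C' := by
  have hguard : (u, Rule.update) ∈ A → ¬ UpToDate M C u := by
    intro hA h
    have := (guard_update_iff.1 (T.activable _ hA).1).2
    rcases this with h1 | h1
    · exact h1 h.1
    · exact h1.1 h.2
  have h1 := ind_mono hguard
  have h2 := ind_le_one (¬ UpToDate M C' u)
  by_cases hfl : ∀ x ∉ M.verts, (C' x).fin = (C x).fin
  · have hb := T.bestRematch_eq (u := u) hfl
    by_cases hA : (u, Rule.update) ∈ A
    · have : UpToDate M C' u := by
        refine ⟨T.wellFormed hu (Or.inr ⟨_, hA⟩), ?_⟩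
        rw [hb, T.exec _ _ hA]; rfl
      rw [ind_false (not_not.2 this)]
      omega
    · have : UpToDate M C u → UpToDate M C' u := by
        rintro ⟨h3, h4⟩
        obtain ⟨h5, h6⟩ := T.candidates hu hA
        exact ⟨T.wellFormed hu (Or.inl h3), by rw [hb, h5, h6, h4]⟩
      have := ind_mono (mt this)
      rw [ind_false hA]; omega
  · push Not at hfl
    obtain ⟨x, hx, h3⟩ := hfl
    have : ind ((C' x).fin ≠ (C x).fin) ≤ flips M C C' :=
      Finset.single_le_sum (f := fun x => ind ((C' x).fin ≠ (C x).fin))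
        (fun _ _ => Nat.zero_le _) (mem_uncovered.2 hx)
    rw [ind_true h3] at this
    omega

/-- The number of executions of `Update`. -/
noncomputable def updateMoves (M : G.Subgraph) (A : Finset (V × Rule)) : ℕ :=
  ∑ u ∈ covered M, ind ((u, .update) ∈ A)

/-- The number of matched nodes that are not up to date. -/
noncomputable def updatePot (M : G.Subgraph) (C : Config V) : ℕ :=
  ∑ u ∈ covered M, ind (¬ UpToDate M C u)

theorem Transition.updateMoves_le (T : Transition M C A C') :
    updateMoves M A + updatePot M C' ≤ updatePot M C + Fintype.card V * flips M C C' := by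
  have h1 := Finset.sum_le_sum (fun u (hu : u ∈ covered M) => T.update_step (mem_covered.1 hu))
  rw [Finset.sum_add_distrib, Finset.sum_add_distrib, Finset.sum_const, smul_eq_mul] at h1
  exact h1.trans (Nat.add_le_add_left (Nat.mul_le_mul_right _ (Finset.card_le_univ _)) _)

/-- A matched process that announces `end` to a single node that has not copied it yet. -/
def Offers (M : G.Subgraph) (C : Config V) (w : V) : Prop :=
  (C w).fin = true ∧ ∃ x ∈ singleNbrs M w, (C w).p = x ∧ ¬ ((C x).p = w ∧ (C x).fin = true)

/-- A matched process that executes a rule which sets `end` to true. -/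
def Announces (A : Finset (V × Rule)) (C' : Config V) (w : V) : Prop :=
  Moves A w ∧ (C' w).fin = true

theorem Transition.rise_source (T : Transition M C A C') (hx : x ∉ M.verts)
    (h : (C x).fin = false ∧ (C' x).fin = true) :
    ∃ w ∈ M.verts, x ∈ singleNbrs M w ∧ (C x).p = w ∧ (C w).p = x ∧ (C w).fin = true ∧
      (C' x).p = w := by
  rcases T.cases_single hx with ⟨-, -, h1⟩ | ⟨-, -, h1, -, -⟩ | ⟨-, -, h1, -⟩ |
      ⟨-, w, hw, h1, h2, h3, h4, h5⟩
  · rw [h1, h.1] at h; simp at h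
  · rw [h.1] at h1; simp at h1
  · rw [h.2] at h1; simp at h1
  · exact ⟨w, hw.2, ⟨hw.1.symm, hx⟩, h1, h2, by rw [← h5, h.2], by rw [h4, h1]⟩

/-- Copying consumes the offer of `w`, and only a move of `w` that leaves its `end` true can open a
new one. -/
theorem Transition.offer_step (T : Transition M C A C') (hw : w ∈ M.verts) :
    ind (∃ x, x ∉ M.verts ∧ (C x).p = w ∧ (C w).p = x ∧ (C x).fin = false ∧ (C' x).fin = true) +
      ind (Offers M C' w) ≤ ind (Offers M C w) + ind (Announces A C' w) := by
  have h1 : (∃ x, x ∉ M.verts ∧ (C x).p = w ∧ (C w).p = x ∧ (C x).fin = false ∧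
      (C' x).fin = true) → Offers M C w := by
    rintro ⟨x, hx, h1, h2, h3⟩
    obtain ⟨w', -, h4, h5, h6, h7, -⟩ := T.rise_source hx h3
    rw [h1] at h5
    obtain rfl := WithTop.coe_injective h5
    exact ⟨h7, x, h4, h2, by simp [h3.1]⟩
  have h1' := ind_mono h1
  have h2 := ind_le_one (Offers M C' w)
  by_cases hm : Moves A w
  · by_cases hf : (C' w).fin = true
    · rw [ind_true (show Announces A C' w from ⟨hm, hf⟩)]; omega
    · rw [ind_false (show ¬ Offers M C' w from fun h => hf h.1)]; omega
  · have hid := T.idle' hm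
    by_cases hx : ∃ x, x ∉ M.verts ∧ (C x).p = w ∧ (C w).p = x ∧ (C x).fin = false ∧
        (C' x).fin = true
    · have : ¬ Offers M C' w := by
        rintro ⟨-, y, -, h3, h4⟩
        obtain ⟨x, hx, h5, h6, h7⟩ := hx
        rw [hid, h6] at h3
        obtain rfl := WithTop.coe_injective h3
        obtain ⟨w', -, -, h8, -, -, h9⟩ := T.rise_source hx h7
        exact h4 ⟨by rw [h9, ← h8, h5], h7.2⟩
      rw [ind_false this]; omega
    · have : Offers M C' w → Offers M C w := by
        rintro ⟨h3, x, h4, h5, h6⟩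
        rw [hid] at h3 h5
        refine ⟨h3, x, h4, h5, ?_⟩
        rintro ⟨h7, h8⟩
        -- A single node that has already copied the value of an idle `w` has no rule to execute, so
        -- the offer cannot reopen.
        apply h6
        obtain ⟨h9, h10⟩ := h4
        rcases T.cases_single h10 with ⟨-, -, h⟩ | ⟨-, h, -⟩ | ⟨-, h, -⟩ | ⟨-, w', -, h, -, h', -, -⟩
        · rw [h]; exact ⟨h7, h8⟩
        · rw [h7] at h; exact absurd h WithTop.coe_ne_top
        · exfalso
          rcases h.2 with h | h | h
          · rw [h7] at h; exact WithTop.coe_ne_top h.1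
          · exact h (mem_withNull.2 (Or.inr ⟨w, ⟨h9.symm, hw⟩, h7⟩))
          · exact h.2 ⟨w, h7, h5⟩
        · rw [h7] at h
          obtain rfl := WithTop.coe_injective h
          rw [h8, h3] at h'; exact absurd rfl h'
      have := ind_mono this
      rw [ind_false hx]; omega

/-- The number of matched nodes that execute a rule which sets `end` to true. -/
noncomputable def announcements (M : G.Subgraph) (A : Finset (V × Rule)) (C' : Config V) : ℕ :=
  ∑ w ∈ covered M, ind (Announces A C' w)

/-- The number of matched nodes with an open offer. -/
noncomputable def offerPot (M : G.Subgraph) (C : Config V) : ℕ :=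
  ∑ w ∈ covered M, ind (Offers M C w)

theorem Transition.rises_le (T : Transition M C A C') :
    rises M C C' + offerPot M C' ≤ offerPot M C + announcements M A C' := by
  have h1 := Finset.sum_le_sum (fun w (hw : w ∈ covered M) => T.offer_step (mem_covered.1 hw))
  rw [Finset.sum_add_distrib, Finset.sum_add_distrib] at h1
  refine le_trans (Nat.add_le_add_right ?_ _) h1
  calc rises M C C' ≤ ∑ x ∈ uncovered M, ∑ w ∈ covered M,
        ind (x ∉ M.verts ∧ (C x).p = w ∧ (C w).p = x ∧ (C x).fin = false ∧
          (C' x).fin = true) := by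
        refine Finset.sum_le_sum (fun x hx => ind_le_sum _ _ (fun h => ?_))
        obtain ⟨w, hw, -, h2, h3, -⟩ := T.rise_source (mem_uncovered.1 hx) h
        exact ⟨w, mem_covered.2 hw, mem_uncovered.1 hx, h2, h3, h⟩
    _ ≤ _ := by
        rw [Finset.sum_comm]
        refine Finset.sum_le_sum (fun w _ => sum_ind_le_ind _ _ ?_)
        rintro i j ⟨-, -, hi, -⟩ ⟨-, -, hj, -⟩
        exact WithTop.coe_injective (hi.symm.trans hj)

end Singles

end MaxMatch

namespace MaxMatch

/-! ### Each matching edge makes boundedly many announcements. -/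

section Announcements

variable {V : Type*} [Fintype V] [LinearOrder V] {G : SimpleGraph V} {M : G.Subgraph}
  {C C' : Config V} {A : Finset (V × Rule)} {u v x w : V}

/-- The property of a matched process that its first move establishes. -/
def Settled (M : G.Subgraph) (C : Config V) (u : V) : Prop :=
  WellFormed M C u ∧ ((C u).s = true → Engaged M C u) ∧ ((C u).fin = true → (C u).s = true)

/-- A boolean is set to true only if the pointer already had the value now written and was answered.
The mutual pair therefore survives the move. -/
theorem Transition.settled (T : Transition M C A C') (hu : u ∈ M.verts)
    (h : Settled M C u ∨ Moves A u) : Settled M C' u := by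
  refine ⟨T.wellFormed hu (h.imp_left (fun h => h.1)), ?_⟩
  rcases T.cases_matched hu with ⟨h1, -, h2⟩ | ⟨-, -, -, h2⟩ | ⟨-, -, -, hw, h2⟩
  · have h3 := h.resolve_right h1
    refine ⟨fun hs => T.engaged hu (h3.2.1 (h2 ▸ hs)) (by rw [h2]), ?_⟩
    rw [h2]; exact h3.2.2
  · simp [h2, command]
  · rcases h2 with ⟨-, h2⟩ | ⟨-, h2⟩ | ⟨-, h2⟩
    · have hs : (C' u).s = true ↔ FirstS M C u := by simp [h2, command]
      have hf : (C' u).fin = true ↔ FirstEnd M C u := by simp [h2, command]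
      have hp : (C' u).p = askFirst M C u := by simp [h2, command]
      rw [hs, hf]
      refine ⟨fun h3 => ?_, fun h3 => ⟨h3.1, h3.2.1, Or.inl h3.2.2.2.1⟩⟩
      exact T.engaged hu (engaged_of_pointedBack hw.2.2.2.2 h3.2.1) (hp.trans h3.1.symm)
    · have hs : (C' u).s = true ↔ SecondEnd M C u := by simp [h2, command]
      have hf : (C' u).fin = true ↔ SecondEnd M C u := by simp [h2, command]
      have hp : (C' u).p = askSecond M C u := by simp [h2, command]
      rw [hs, hf]
      refine ⟨fun h3 => ?_, fun h3 => h3⟩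
      exact T.engaged hu (engaged_of_pointedBack hw.2.2.2.2 h3.2.1) (hp.trans h3.1.symm)
    · simp [h2, command]

theorem Transition.announces_cases (T : Transition M C A C') (hu : u ∈ M.verts)
    (h : Announces A C' u) :
    (u, .update) ∉ A ∧ WellFormed M C u ∧ Engaged M C u ∧ (C' u).p = (C u).p ∧
      (C' u).s = true ∧
      ((Guard M C u .matchFirst ∧ askFirst M C u ≠ ⊤ ∧ (C u).p = askFirst M C u ∧
        (C u).s = true ∧
        (C (mate M u)).p = askSecond M C (mate M u) ∧ (C (mate M u)).fin = true) ∨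
       (Guard M C u .matchSecond ∧ askSecond M C u ≠ ⊤ ∧ (C u).p = askSecond M C u ∧
        (C (mate M u)).s = true ∧ (C (mate M u)).p = askFirst M C (mate M u))) := by
  obtain ⟨hm, hf⟩ := h
  rcases T.cases_matched hu with ⟨h1, -, h2⟩ | ⟨-, -, -, h2⟩ | ⟨-, hA, -, hw, h2⟩
  · exact absurd hm h1
  · simp [h2, command] at hf
  · refine ⟨hA, hw, ?_⟩
    rcases h2 with ⟨hg, h2⟩ | ⟨hg, h2⟩ | ⟨-, h2⟩
    · have hf' : FirstEnd M C u := by simpa [h2, command] using hf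
      refine ⟨engaged_of_pointedBack hw.2.2.2.2 hf'.2.1, ?_, ?_, Or.inl ⟨hg, hg.2.1, hf'.1,
        hf'.2.2.1, hf'.2.2.2.1, hf'.2.2.2.2⟩⟩
      · rw [h2, hf'.1]; rfl
      · have : FirstS M C u := ⟨hf'.1, hf'.2.1, Or.inl hf'.2.2.2.1⟩
        simpa [h2, command]
    · have hf' : SecondEnd M C u := by simpa [h2, command] using hf
      refine ⟨engaged_of_pointedBack hw.2.2.2.2 hf'.2.1, ?_, ?_, Or.inr ⟨hg, hg.2.1, hf'.1,
        hg.2.2.1, hf'.2.2⟩⟩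
      · rw [h2, hf'.1]; rfl
      · simpa [h2, command]
    · simp [h2, command] at hf

/-- A process that has announced `end` and does not move before its mate does. -/
def Done (M : G.Subgraph) (C : Config V) (u : V) : Prop :=
  WellFormed M C u ∧ Engaged M C u ∧ (C u).s = true ∧ (C u).fin = true ∧
    ((askFirst M C u ≠ ⊤ ∧ (C u).p = askFirst M C u ∧
        (C (mate M u)).p = askSecond M C (mate M u) ∧ (C (mate M u)).fin = true) ∨
     (askSecond M C u ≠ ⊤ ∧ (C u).p = askSecond M C u ∧
        (C (mate M u)).s = true ∧ (C (mate M u)).p = askFirst M C (mate M u)))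

/-- All variables already have the values that the applicable match rule would write, and engagement
excludes `Update`. -/
theorem Transition.not_moves_of_done (hM : M.IsMatching) (T : Transition M C A C')
    (hu : u ∈ M.verts) (h : Done M C u) : ¬ Moves A u := by
  obtain ⟨hw, he, hs, hf, h⟩ := h
  have hpb := he.pointedBack
  intro hm
  rcases T.cases_matched hu with ⟨h1, -, -⟩ | ⟨-, -, h1, -⟩ | ⟨-, -, -, -, h2⟩
  · exact h1 hm
  · exact not_guard_update hw he h1
  · rcases h with ⟨h3, h4, h5, h6⟩ | ⟨h3, h4, h5, h6⟩
    · have h7 := askSecond_of_askFirst hM hu h3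
      rcases h2 with ⟨⟨-, -, hg⟩, -⟩ | ⟨hg, -⟩ | ⟨⟨-, hg⟩, -⟩
      · rcases hg with hg | hg | hg
        · exact hg h4
        · exact hg ⟨fun _ => ⟨h4, hpb, Or.inl h5⟩, fun _ => hs⟩
        · exact hg ⟨fun _ => ⟨h4, hpb, hs, h5, h6⟩, fun _ => hf⟩
      · exact hg.2.1 h7
      · rcases hg with hg | hg
        · exact h3 hg.1
        · exact hg.1 h7
    · have h7 := askFirst_of_askSecond hM hu h3
      rcases h2 with ⟨hg, -⟩ | ⟨⟨-, -, -, hg⟩, -⟩ | ⟨⟨-, hg⟩, -⟩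
      · exact hg.2.1 h7
      · rcases hg with hg | hg | hg
        · exact hg h4
        · exact hg ⟨fun _ => ⟨h4, hpb, h6⟩, fun _ => hf⟩
        · exact hg (by rw [hs, hf])
      · rcases hg with hg | hg
        · exact h3 hg.2.1
        · rw [h5] at hg; simp at hg

/-- The conditions under which a node announces concern its mate in the old configuration. If the
mate is idle they still hold afterwards. -/
theorem Transition.done_of_idle (hM : M.IsMatching) (T : Transition M C A C')
    (hu : u ∈ M.verts) (hv : ¬ Moves A (mate M u)) (h : Done M C u ∨ Announces A C' u) :
    Done M C' u := by
  have hvid := T.idle' hv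
  have hvA : (mate M u, Rule.update) ∉ A := fun h => hv ⟨_, h⟩
  have hv' := mate_mem hM hu
  rcases h with h | h
  · have hm := T.not_moves_of_done hM hu h
    have huA : (u, Rule.update) ∉ A := fun h => hm ⟨_, h⟩
    obtain ⟨a1, a2⟩ := T.asks hM hu huA hvA
    obtain ⟨a3, a4⟩ := T.asks hM hv' hvA (by rwa [mate_mate hM hu])
    have hid := T.idle' hm
    obtain ⟨hw, he, hs, hf, h⟩ := h
    refine ⟨hw.of_eq hid, T.engaged hu he (by rw [hid]), by rw [hid, hs], by rw [hid, hf], ?_⟩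
    rw [a1, a2, a3, a4, hid, hvid]
    exact h
  · obtain ⟨huA, hw, he, hp, hs, hc⟩ := T.announces_cases hu h
    obtain ⟨a1, a2⟩ := T.asks hM hu huA hvA
    obtain ⟨a3, a4⟩ := T.asks hM hv' hvA (by rwa [mate_mate hM hu])
    refine ⟨T.wellFormed hu (Or.inl hw), T.engaged hu he hp, hs, h.2, ?_⟩
    rw [a1, a2, a3, a4, hp, hvid]
    rcases hc with hc | hc
    · exact Or.inl ⟨hc.2.1, hc.2.2.1, hc.2.2.2.2⟩
    · exact Or.inr hc.2

/-- The augmenting path through `u`, which points first, and its mate is complete. -/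
def Locked (M : G.Subgraph) (C : Config V) (u : V) : Prop :=
  askFirst M C u ≠ ⊤ ∧ WellFormed M C u ∧ Engaged M C u ∧ (C u).s = true ∧
    (C u).p = askFirst M C u ∧ Done M C (mate M u)

/-- The mate is idle because it is done, and engagement excludes `Update` for `u`. The only move
left to `u` is `MatchFirst`, raising `end` and keeping everything that the mate relies on. -/
theorem Transition.locked (hM : M.IsMatching) (T : Transition M C A C')
    (hu : u ∈ M.verts) (h : Locked M C u) :
    Locked M C' u ∧ ¬ Moves A (mate M u) ∧
      (Moves A u → (C u).fin = false ∧ (C' u).fin = true) ∧ (C (mate M u)).fin = true := by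
  obtain ⟨h1, hw, he, hs, hp, hd⟩ := h
  have hv' := mate_mem hM hu
  have hv := T.not_moves_of_done hM hv' hd
  have hvid := T.idle' hv
  have hvA : (mate M u, Rule.update) ∉ A := fun h => hv ⟨_, h⟩
  have hvp : (C (mate M u)).p = askSecond M C (mate M u) := by
    rcases hd.2.2.2.2 with h | h
    · exact absurd (askFirst_mate hM hu h1) h.1
    · exact h.2.1
  have h2 := askSecond_of_askFirst hM hu h1
  have huA : (u, Rule.update) ∉ A := fun h => not_guard_update hw he (T.activable _ h).1
  have hfs : FirstS M C u := ⟨hp, he.pointedBack, Or.inl hvp⟩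
  have hfe : FirstEnd M C u := ⟨hp, he.pointedBack, hs, hvp, hd.2.2.2.1⟩
  obtain ⟨a1, a2⟩ := T.asks hM hu huA hvA
  obtain ⟨a3, a4⟩ := T.asks hM hv' hvA (by rwa [mate_mate hM hu])
  have key : (C' u).p = (C u).p ∧ (C' u).s = true ∧
      (Moves A u → (C u).fin = false ∧ (C' u).fin = true) := by
    rcases T.cases_matched hu with ⟨g1, -, g2⟩ | ⟨-, g1, -, -⟩ | ⟨-, -, -, -, g2⟩
    · exact ⟨by rw [g2], by rw [g2, hs], fun h => absurd h g1⟩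
    · exact absurd g1 huA
    · rcases g2 with ⟨⟨-, -, hg⟩, g2⟩ | ⟨hg, -⟩ | ⟨⟨-, hg⟩, -⟩
      · refine ⟨by rw [g2, hp]; rfl, by simpa [g2, command], fun _ => ⟨?_, by simpa [g2, command]⟩⟩
        rcases hg with hg | hg | hg
        · exact absurd hp hg
        · exact absurd ⟨fun _ => hfs, fun _ => hs⟩ hg
        · by_contra hc
          exact hg ⟨fun _ => hfe, fun _ => by simpa using hc⟩
      · exact absurd h2 hg.2.1
      · rcases hg with hg | hg
        · exact absurd hg.1 h1
        · exact absurd h2 hg.1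
  obtain ⟨k1, k2, k3⟩ := key
  refine ⟨⟨by rwa [a1], T.wellFormed hu (Or.inl hw), T.engaged hu he k1, k2, by rw [a1, k1, hp],
    ?_⟩, hv, k3, hd.2.2.2.1⟩
  obtain ⟨d1, d2, d3, d4, d5⟩ := hd
  refine ⟨d1.of_eq hvid, T.engaged hv' d2 (by rw [hvid]), by rw [hvid, d3], by rw [hvid, d4], ?_⟩
  rw [mate_mate hM hu] at d5 ⊢
  rw [a1, a2, a3, a4, hvid, k1, k2]
  rcases d5 with d5 | d5
  · exact absurd (askFirst_mate hM hu h1) d5.1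
  · exact Or.inr ⟨d5.1, d5.2.1, rfl, d5.2.2.2⟩

/-- If `u` points first, it announces only when its mate has `end` true, and for a settled mate this
means that the path was complete. If `u` points second, its own announcement completes the path. -/
theorem Transition.locked_of_announces (hM : M.IsMatching) (T : Transition M C A C')
    (hu : u ∈ M.verts) (hv : Settled M C (mate M u)) (h : Announces A C' u) :
    Locked M C u ∨ Locked M C' (mate M u) := by
  have hv' := mate_mem hM hu
  obtain ⟨huA, hw, he, hp, hs, hc⟩ := T.announces_cases hu h
  rcases hc with ⟨-, h1, h2, h3, h4, h5⟩ | ⟨hg, h1, h2, h3, h4⟩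
  · left
    have h6 := hv.2.2 h5
    have h7 := hv.2.1 h6
    refine ⟨h1, hw, he, h3, h2, hv.1, h7, h6, h5, Or.inr ?_⟩
    rw [mate_mate hM hu]
    exact ⟨by rw [← h4]; exact h7.p_ne_top, h4, h3, h2⟩
  · right
    have hve := hv.2.1 h3
    have hvA : (mate M u, Rule.update) ∉ A :=
      fun h => not_guard_update hv.1 hve (T.activable _ h).1
    obtain ⟨a1, a2⟩ := T.asks hM hu huA hvA
    obtain ⟨a3, a4⟩ := T.asks hM hv' hvA (by rwa [mate_mate hM hu])
    have hvf := askSecond_ne_top h1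
    have hvs := askSecond_of_askFirst hM hv' hvf
    -- The end that points first may move at the same time, but only by `MatchFirst`, which rewrites
    -- the same pointer and a true `s`.
    have key : (C' (mate M u)).p = (C (mate M u)).p ∧ (C' (mate M u)).s = true := by
      rcases T.cases_matched hv' with ⟨g1, -, g2⟩ | ⟨-, g1, -, -⟩ | ⟨-, -, -, -, g2⟩
      · exact ⟨by rw [g2], by rw [g2, h3]⟩
      · exact absurd g1 hvA
      · rcases g2 with ⟨-, g2⟩ | ⟨hg, -⟩ | ⟨⟨-, hg⟩, -⟩
        · have : FirstS M C (mate M u) :=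
            ⟨h4, hve.pointedBack, Or.inl (by rwa [mate_mate hM hu])⟩
          exact ⟨by rw [g2, h4]; rfl, by simpa [g2, command]⟩
        · exact absurd hvs hg.2.1
        · rcases hg with hg | hg
          · exact absurd hg.1 hvf
          · exact absurd hvs hg.1
    refine ⟨by rwa [a3], T.wellFormed hv' (Or.inl hv.1), T.engaged hv' hve key.1, key.2,
      by rw [a3, key.1, h4], ?_⟩
    rw [mate_mate hM hu]
    refine ⟨T.wellFormed hu (Or.inl hw), T.engaged hu he hp, hs, h.2, Or.inr ?_⟩
    rw [a2, a3, hp, key.1]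
    exact ⟨h1, h2, key.2, h4⟩

/-- The potential of a matching edge that bounds the number of its announcements. -/
noncomputable def announcePot (M : G.Subgraph) (C : Config V) (u : V) : ℕ :=
  open Classical in
  if Settled M C u ∧ Settled M C (mate M u) then
    if Locked M C u ∨ Locked M C (mate M u) then
      ind (¬ ((C u).fin = true ∧ (C (mate M u)).fin = true))
    else 2
  else 2 + 4 * (ind (¬ Settled M C u) + ind (¬ Settled M C (mate M u))) +
    ind (¬ Done M C u ∧ ¬ Settled M C (mate M u)) +
    ind (¬ Done M C (mate M u) ∧ ¬ Settled M C u)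

theorem announcePot_le : announcePot M C u ≤ 12 := by
  unfold announcePot
  have h1 := ind_le_one (¬ Settled M C u)
  have h2 := ind_le_one (¬ Settled M C (mate M u))
  have h3 := ind_le_one (¬ Done M C u ∧ ¬ Settled M C (mate M u))
  have h4 := ind_le_one (¬ Done M C (mate M u) ∧ ¬ Settled M C u)
  have h5 := ind_le_one (¬ ((C u).fin = true ∧ (C (mate M u)).fin = true))
  split_ifs <;> omega

theorem announcePot_le_two (h : Settled M C u ∧ Settled M C (mate M u)) :
    announcePot M C u ≤ 2 := by
  unfold announcePot
  have h5 := ind_le_one (¬ ((C u).fin = true ∧ (C (mate M u)).fin = true))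
  rw [if_pos h]
  split_ifs <;> omega

/-- A settled edge announces at most twice, since its first announcement locks it unless it is
locked already. The first move of an unsettled end releases 4 units, enough for two announcements in
that transition and one reappearing indicator. While an unsettled end stays idle, its mate announces
at most once, because it is then done. -/
theorem Transition.announce_step (hM : M.IsMatching) (T : Transition M C A C')
    (hu : u ∈ M.verts) :
    ind (Announces A C' u) + ind (Announces A C' (mate M u)) + announcePot M C' u ≤
      announcePot M C u := by
  have hv := mate_mem hM hu
  have b1 := ind_le_one (Announces A C' u)
  have b2 := ind_le_one (Announces A C' (mate M u))
  have su := T.settled hu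
  have sv := T.settled hv
  by_cases hS : Settled M C u ∧ Settled M C (mate M u)
  · have hS' : Settled M C' u ∧ Settled M C' (mate M u) := ⟨su (Or.inl hS.1), sv (Or.inl hS.2)⟩
    by_cases hL : Locked M C u ∨ Locked M C (mate M u)
    · have hL' : Locked M C' u ∨ Locked M C' (mate M u) :=
        hL.imp (fun h => (T.locked hM hu h).1) (fun h => (T.locked hM hv h).1)
      unfold announcePot
      rw [if_pos hS, if_pos hS', if_pos hL, if_pos hL']
      rcases hL with h | h
      · obtain ⟨-, h1, h2, h3⟩ := T.locked hM hu h
        have hid := T.idle' h1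
        rw [ind_false (show ¬ Announces A C' (mate M u) from fun h => h1 h.1), hid]
        by_cases hm : Moves A u
        · obtain ⟨h4, h5⟩ := h2 hm
          simp [ind, h3, h4, h5, Announces, hm]
        · simp [ind, T.idle' hm, Announces, hm]
      · obtain ⟨-, h1, h2, h3⟩ := T.locked hM hv h
        rw [mate_mate hM hu] at h1 h3
        have hid := T.idle' h1
        rw [ind_false (show ¬ Announces A C' u from fun h => h1 h.1), hid]
        by_cases hm : Moves A (mate M u)
        · obtain ⟨h4, h5⟩ := h2 hm
          simp [ind, h3, h4, h5, Announces, hm]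
        · simp [ind, T.idle' hm, Announces, hm]
    · have e1 : announcePot M C u = 2 := by
        unfold announcePot; rw [if_pos hS, if_neg hL]
      by_cases hA : Announces A C' u ∨ Announces A C' (mate M u)
      · have hL' : Locked M C' u ∨ Locked M C' (mate M u) := by
          rcases hA with h | h
          · rcases T.locked_of_announces hM hu hS.2 h with h1 | h1
            · exact absurd (Or.inl h1) hL
            · exact Or.inr h1
          · rcases T.locked_of_announces hM hv (by rw [mate_mate hM hu]; exact hS.1) h with h1 | h1
            · exact absurd (Or.inr h1) hL
            · rw [mate_mate hM hu] at h1; exact Or.inl h1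
        rw [e1]
        unfold announcePot
        rw [if_pos hS', if_pos hL']
        have : ¬ Announces A C' u ∨ ¬ Announces A C' (mate M u) ∨
            ((C' u).fin = true ∧ (C' (mate M u)).fin = true) := by
          by_cases h1 : Announces A C' u
          · by_cases h2 : Announces A C' (mate M u)
            · exact Or.inr (Or.inr ⟨h1.2, h2.2⟩)
            · exact Or.inr (Or.inl h2)
          · exact Or.inl h1
        have b3 := ind_le_one (¬ ((C' u).fin = true ∧ (C' (mate M u)).fin = true))
        rcases this with h | h | h
        · rw [ind_false h]; omega
        · rw [ind_false h]; omega
        · rw [ind_false (not_not.2 h)]; omega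
      · rw [not_or] at hA
        rw [ind_false hA.1, ind_false hA.2, e1]
        have := announcePot_le_two hS'
        omega
  · have e1 : announcePot M C u = 2 + 4 * (ind (¬ Settled M C u) +
        ind (¬ Settled M C (mate M u))) +
        ind (¬ Done M C u ∧ ¬ Settled M C (mate M u)) +
        ind (¬ Done M C (mate M u) ∧ ¬ Settled M C u) := by
      unfold announcePot; rw [if_neg hS]
    have e2 : announcePot M C' u ≤ 2 + 4 * (ind (¬ Settled M C' u) +
        ind (¬ Settled M C' (mate M u))) +
        ind (¬ Done M C' u ∧ ¬ Settled M C' (mate M u)) +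
        ind (¬ Done M C' (mate M u) ∧ ¬ Settled M C' u) := by
      by_cases hS' : Settled M C' u ∧ Settled M C' (mate M u)
      · have := announcePot_le_two hS'; omega
      · unfold announcePot; rw [if_neg hS']
    rw [e1]
    refine le_trans (Nat.add_le_add_left e2 _) ?_
    have m1 := ind_mono (mt (fun h => su (Or.inl h)))
    have m2 := ind_mono (mt (fun h => sv (Or.inl h)))
    have c1 := ind_le_one (¬ Done M C' u ∧ ¬ Settled M C' (mate M u))
    have c2 := ind_le_one (¬ Done M C' (mate M u) ∧ ¬ Settled M C' u)
    by_cases hu1 : ¬ Settled M C u ∧ Moves A u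
    · rw [ind_true hu1.1]
      rw [ind_false (p := ¬ Settled M C' u) (not_not.2 (su (Or.inr hu1.2)))]
      have c3 : ind (¬ Done M C' (mate M u) ∧ ¬ Settled M C' u) = 0 :=
        ind_false (fun h => h.2 (su (Or.inr hu1.2)))
      omega
    by_cases hv1 : ¬ Settled M C (mate M u) ∧ Moves A (mate M u)
    · rw [ind_true hv1.1]
      rw [ind_false (p := ¬ Settled M C' (mate M u)) (not_not.2 (sv (Or.inr hv1.2)))]
      have c3 : ind (¬ Done M C' u ∧ ¬ Settled M C' (mate M u)) = 0 :=
        ind_false (fun h => h.2 (sv (Or.inr hv1.2)))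
      omega
    -- the processes that are not settled stay idle
    have key : ∀ w ∈ M.verts, ¬ (¬ Settled M C (mate M w) ∧ Moves A (mate M w)) →
        ¬ (¬ Settled M C w ∧ Moves A w) → ¬ (Settled M C w ∧ Settled M C (mate M w)) →
        ind (Announces A C' w) + ind (¬ Done M C' w ∧ ¬ Settled M C' (mate M w)) ≤
          ind (¬ Done M C w ∧ ¬ Settled M C (mate M w)) := by
      intro w hw h1 h2 h3
      by_cases hs : Settled M C (mate M w)
      · have h4 : ¬ Moves A w := fun h => h2 ⟨fun h' => h3 ⟨h', hs⟩, h⟩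
        rw [ind_false (p := Announces A C' w) (fun h => h4 h.1),
          ind_false (p := ¬ Done M C' w ∧ ¬ Settled M C' (mate M w))
            (fun h => h.2 (T.settled (mate_mem hM hw) (Or.inl hs)))]
        exact Nat.zero_le _
      · have h4 : ¬ Moves A (mate M w) := fun h => h1 ⟨hs, h⟩
        have h5 := T.done_of_idle hM hw h4
        by_cases ha : Announces A C' w
        · rw [ind_true ha, ind_false (fun h => h.1 (h5 (Or.inr ha))), ind_true]
          exact ⟨fun h => T.not_moves_of_done hM hw h ha.1, hs⟩
        · rw [ind_false ha, zero_add]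
          exact ind_mono (fun h => ⟨fun h' => h.1 (h5 (Or.inl h')), hs⟩)
    have k1 := key u hu hv1 hu1 hS
    have k2 := key (mate M u) hv (by rwa [mate_mate hM hu]) hv1
      (by rw [mate_mate hM hu]; exact fun h => hS h.symm)
    rw [mate_mate hM hu] at k2
    omega

/-- The total potential of the announcements. -/
noncomputable def totalAnnouncePot (M : G.Subgraph) (C : Config V) : ℕ :=
  ∑ u ∈ covered M, announcePot M C u

theorem Transition.announcements_le (hM : M.IsMatching) (T : Transition M C A C') :
    announcements M A C' + totalAnnouncePot M C' ≤ totalAnnouncePot M C := by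
  unfold announcements totalAnnouncePot
  rw [← Finset.sum_add_distrib]
  refine Finset.sum_le_sum (fun u hu => ?_)
  have := T.announce_step hM (mem_covered.1 hu)
  omega

end Announcements

end MaxMatch

/-! ### The weight of a matching edge with frozen candidates. -/

namespace MaxMatch

theorem ind_lt {p q : Prop} (h : p ∧ ¬ q) : ind q < ind p := by
  rw [ind_true h.1, ind_false h.2]; exact Nat.zero_lt_one

/-- The weight of the local state of a matching edge: `a`, `su`, `eu` describe the pointer and the
booleans of the end that points first, `b` whether it is engaged, `d` and `n` whether the other end
points to its target (which is null if `z`) or to null, `sv`, `ev` its booleans, `g` whether it is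
engaged. -/
noncomputable def weight (a b d n z g su sv eu ev : Prop) : ℕ :=
  64 * (ind (¬ a) + ind (¬ b) + ind (¬ (d ∨ n)) + ind (z ∧ ¬ (n ∧ ¬ sv ∧ ¬ ev))) +
  32 * ind (¬ (su ↔ b ∧ (d ∨ n))) + 16 * ind (¬ z ∧ ¬ ((su ∧ d) ∨ (¬ su ∧ n))) +
  8 * ind (¬ (d ∧ g)) + 4 * ind (¬ z ∧ su ∧ ¬ ((ev ↔ d ∧ g ∧ a) ∧ (sv ↔ ev))) +
  2 * ind (¬ (eu ↔ b ∧ su ∧ d ∧ ev))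

/-- The indicators record errors, ordered so that each one can be created only by a change at an
earlier level. The four errors of weight 64 never reappear. After them come `su`, the pointer of the
second end, its engagement, its booleans, and finally `eu`. At the first level where something
relevant changes, an error disappears, and its weight is at least that of all later levels plus the
two possible moves. -/
theorem weight_step {a b d n z g su sv eu ev a' b' d' n' g' su' sv' eu' ev' mu mv : Prop}
    (hz : z → (d ↔ n)) (hz' : z → (d' ↔ n')) (hnz : ¬ z → ¬ (d ∧ n))
    (hnz' : ¬ z → ¬ (d' ∧ n')) (hb : b → b') (hdg : d ∧ d' → g → g')
    (hu : (¬ mu ∧ (a' ↔ a) ∧ (su' ↔ su) ∧ (eu' ↔ eu)) ∨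
      (mu ∧ a' ∧ (su' ↔ b ∧ (d ∨ n)) ∧ (eu' ↔ b ∧ su ∧ d ∧ ev) ∧
        ¬ (a ∧ (su ↔ b ∧ (d ∨ n)) ∧ (eu ↔ b ∧ su ∧ d ∧ ev))))
    (hv : (¬ mv ∧ (d' ↔ d) ∧ (n' ↔ n) ∧ (sv' ↔ sv) ∧ (ev' ↔ ev)) ∨
      (mv ∧ ¬ z ∧ su ∧ d' ∧ (ev' ↔ d ∧ g ∧ a) ∧ (sv' ↔ d ∧ g ∧ a) ∧
        ¬ (d ∧ (ev ↔ d ∧ g ∧ a) ∧ (sv ↔ ev))) ∨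
      (mv ∧ n' ∧ ¬ sv' ∧ ¬ ev' ∧ ((z ∧ ¬ (n ∧ ¬ sv ∧ ¬ ev)) ∨ (¬ z ∧ ¬ n ∧ ¬ su)))) :
    ind mu + ind mv + weight a' b' d' n' z g' su' sv' eu' ev' ≤
      weight a b d n z g su sv eu ev := by
  have h1a : ¬ a' → ¬ a := by grind
  have h1b : ¬ b' → ¬ b := mt hb
  have h1c : ¬ (d' ∨ n') → ¬ (d ∨ n) := by grind
  have h1r : (z ∧ ¬ (n' ∧ ¬ sv' ∧ ¬ ev')) → (z ∧ ¬ (n ∧ ¬ sv ∧ ¬ ev)) := by grind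
  unfold weight
  have bu := ind_le_one mu
  have bv := ind_le_one mv
  -- The later levels weigh at most 32 + 16 + 8 + 4 + 2 = 62, so a drop by 64 also covers two moves.
  by_cases D1 : (¬ a ∧ ¬ ¬ a') ∨ (¬ b ∧ ¬ ¬ b') ∨ (¬ (d ∨ n) ∧ ¬ ¬ (d' ∨ n')) ∨
      ((z ∧ ¬ (n ∧ ¬ sv ∧ ¬ ev)) ∧ ¬ (z ∧ ¬ (n' ∧ ¬ sv' ∧ ¬ ev')))
  · have m1 := ind_mono h1a
    have m2 := ind_mono h1b
    have m3 := ind_mono h1c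
    have m4 := ind_mono h1r
    have c2 := ind_le_one (¬ (su' ↔ b' ∧ (d' ∨ n')))
    have c3 := ind_le_one (¬ z ∧ ¬ ((su' ∧ d') ∨ (¬ su' ∧ n')))
    have c4 := ind_le_one (¬ (d' ∧ g'))
    have c5 := ind_le_one (¬ z ∧ su' ∧ ¬ ((ev' ↔ d' ∧ g' ∧ a') ∧ (sv' ↔ ev')))
    have c6 := ind_le_one (¬ (eu' ↔ b' ∧ su' ∧ d' ∧ ev'))
    rcases D1 with D | D | D | D <;> have := ind_lt D <;> omega
  have ea : a' ↔ a := by grind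
  have eb : b' ↔ b := by grind
  have ec : (d' ∨ n') ↔ (d ∨ n) := by grind
  have er : (z ∧ ¬ (n' ∧ ¬ sv' ∧ ¬ ev')) ↔ (z ∧ ¬ (n ∧ ¬ sv ∧ ¬ ev)) := by grind
  -- With a null target the second end can only reset, which would have repaired the fourth error.
  have ez : z → ¬ mv := by grind
  rw [ind_congr (not_congr ea), ind_congr (not_congr eb), ind_congr (not_congr ec), ind_congr er]
  clear D1 h1a h1b h1c h1r hb
  have hu' : (¬ mu ∧ (su' ↔ su) ∧ (eu' ↔ eu)) ∨
      (mu ∧ (su' ↔ b ∧ (d ∨ n)) ∧ (eu' ↔ b ∧ su ∧ d ∧ ev) ∧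
        ¬ ((su ↔ b ∧ (d ∨ n)) ∧ (eu ↔ b ∧ su ∧ d ∧ ev))) := by
    rcases hu with hu | hu
    · exact Or.inl ⟨hu.1, hu.2.2⟩
    · exact Or.inr ⟨hu.1, hu.2.2.1, hu.2.2.2.1, fun h => hu.2.2.2.2 ⟨ea.1 hu.2.1, h⟩⟩
  clear hu er
  -- A changed `su` was just written, and its inputs are now fixed, so the new value is correct.
  by_cases es : su' ↔ su
  swap
  · have D : ¬ (su ↔ b ∧ (d ∨ n)) ∧ ¬ ¬ (su' ↔ b' ∧ (d' ∨ n')) := by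
      rw [eb, ec]; grind
    have c3 := ind_le_one (¬ z ∧ ¬ ((su' ∧ d') ∨ (¬ su' ∧ n')))
    have c4 := ind_le_one (¬ (d' ∧ g'))
    have c5 := ind_le_one (¬ z ∧ su' ∧ ¬ ((ev' ↔ d' ∧ g' ∧ a') ∧ (sv' ↔ ev')))
    have c6 := ind_le_one (¬ (eu' ↔ b' ∧ su' ∧ d' ∧ ev'))
    have := ind_lt D
    omega
  have e2 : ¬ (su' ↔ b' ∧ (d' ∨ n')) ↔ ¬ (su ↔ b ∧ (d ∨ n)) := by rw [es, eb, ec]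
  rw [ind_congr e2]
  have hu2 : (¬ mu ∧ (eu' ↔ eu)) ∨
      (mu ∧ (eu' ↔ b ∧ su ∧ d ∧ ev) ∧ ¬ (eu ↔ b ∧ su ∧ d ∧ ev)) := by grind
  clear hu' e2
  -- A changed pointer of the second end now agrees with the unchanged `su`.
  by_cases ed : (d' ↔ d) ∧ (n' ↔ n)
  swap
  · have D : (¬ z ∧ ¬ ((su ∧ d) ∨ (¬ su ∧ n))) ∧
        ¬ (¬ z ∧ ¬ ((su' ∧ d') ∨ (¬ su' ∧ n'))) := by
      rw [es]; grind
    have c4 := ind_le_one (¬ (d' ∧ g'))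
    have c5 := ind_le_one (¬ z ∧ su' ∧ ¬ ((ev' ↔ d' ∧ g' ∧ a') ∧ (sv' ↔ ev')))
    have c6 := ind_le_one (¬ (eu' ↔ b' ∧ su' ∧ d' ∧ ev'))
    have := ind_lt D
    omega
  obtain ⟨ed, en⟩ := ed
  have e3 : (¬ z ∧ ¬ ((su' ∧ d') ∨ (¬ su' ∧ n'))) ↔ (¬ z ∧ ¬ ((su ∧ d) ∨ (¬ su ∧ n))) := by
    rw [es, ed, en]
  rw [ind_congr e3]
  have hv2 : (¬ mv ∧ (sv' ↔ sv) ∧ (ev' ↔ ev)) ∨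
      (mv ∧ ¬ z ∧ su ∧ (ev' ↔ d ∧ g ∧ a) ∧ (sv' ↔ d ∧ g ∧ a) ∧
        ¬ ((ev ↔ d ∧ g ∧ a) ∧ (sv ↔ ev))) := by grind
  clear hv e3 hz hz' hnz hnz' ec ez
  -- With the pointer unchanged, engagement of the second end can only be gained.
  by_cases eg : ¬ (d' ∧ g') ↔ ¬ (d ∧ g)
  swap
  · have D : ¬ (d ∧ g) ∧ ¬ ¬ (d' ∧ g') := by grind
    have c5 := ind_le_one (¬ z ∧ su' ∧ ¬ ((ev' ↔ d' ∧ g' ∧ a') ∧ (sv' ↔ ev')))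
    have c6 := ind_le_one (¬ (eu' ↔ b' ∧ su' ∧ d' ∧ ev'))
    have := ind_lt D
    omega
  rw [ind_congr eg]
  have eg' : d' ∧ g' ∧ a' ↔ d ∧ g ∧ a := by grind
  rw [ind_congr (p := ¬ z ∧ su' ∧ ¬ ((ev' ↔ d' ∧ g' ∧ a') ∧ (sv' ↔ ev')))
    (q := ¬ z ∧ su ∧ ¬ ((ev' ↔ d ∧ g ∧ a) ∧ (sv' ↔ ev'))) (by rw [es, eg']),
    ind_congr (p := ¬ (eu' ↔ b' ∧ su' ∧ d' ∧ ev')) (q := ¬ (eu' ↔ b ∧ su ∧ d ∧ ev'))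
      (by rw [es, eb, ed])]
  rcases hv2 with ⟨hv, k1, k2⟩ | ⟨hv, hz, k0, k1, k2, k3⟩
  · rw [k1, k2, ind_false hv]
    rcases hu2 with ⟨h1, h2⟩ | ⟨h1, h2, h3⟩
    · rw [ind_false h1, h2]; omega
    · have := ind_lt (p := ¬ (eu ↔ b ∧ su ∧ d ∧ ev)) (q := ¬ (eu' ↔ b ∧ su ∧ d ∧ ev))
        ⟨h3, not_not.2 h2⟩
      omega
  · have D : (¬ z ∧ su ∧ ¬ ((ev ↔ d ∧ g ∧ a) ∧ (sv ↔ ev))) ∧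
        ¬ (¬ z ∧ su ∧ ¬ ((ev' ↔ d ∧ g ∧ a) ∧ (sv' ↔ ev'))) :=
      ⟨⟨hz, k0, k3⟩, fun h => h.2.2 ⟨k1, k2.trans k1.symm⟩⟩
    have c6 := ind_le_one (¬ (eu' ↔ b ∧ su ∧ d ∧ ev'))
    have := ind_lt D
    omega

theorem weight_le (a b d n z g su sv eu ev : Prop) : weight a b d n z g su sv eu ev ≤ 318 := by
  unfold weight
  have c0 := ind_le_one (¬ a)
  have c1 := ind_le_one (¬ b)
  have c2 := ind_le_one (¬ (d ∨ n))
  have c3 := ind_le_one (z ∧ ¬ (n ∧ ¬ sv ∧ ¬ ev))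
  have c4 := ind_le_one (¬ (su ↔ b ∧ (d ∨ n)))
  have c5 := ind_le_one (¬ z ∧ ¬ ((su ∧ d) ∨ (¬ su ∧ n)))
  have c6 := ind_le_one (¬ (d ∧ g))
  have c7 := ind_le_one (¬ z ∧ su ∧ ¬ ((ev ↔ d ∧ g ∧ a) ∧ (sv ↔ ev)))
  have c8 := ind_le_one (¬ (eu ↔ b ∧ su ∧ d ∧ ev))
  omega

/-! ### Moves per matching edge, and the global potential. -/

section Edges

variable {V : Type*} [Fintype V] [LinearOrder V] {G : SimpleGraph V} {M : G.Subgraph}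
  {C C' : Config V} {A : Finset (V × Rule)} {u v x w : V}

/-- The weight of the matching edge of `u` if `u` is the end that points first. -/
noncomputable def firstWeight (M : G.Subgraph) (C : Config V) (u : V) : ℕ :=
  weight ((C u).p = askFirst M C u) ((C u).p = askFirst M C u ∧ Engaged M C u)
    ((C (mate M u)).p = askSecond M C (mate M u)) ((C (mate M u)).p = ⊤)
    (askSecond M C (mate M u) = ⊤) (Engaged M C (mate M u)) ((C u).s = true)
    ((C (mate M u)).s = true) ((C u).fin = true) ((C (mate M u)).fin = true)

/-- Without `Update` the asks are constant. The first end can then only execute `MatchFirst`, and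
the second only `MatchSecond` or `ResetMatch`, which are the moves covered by `weight_step`. -/
theorem Transition.firstWeight_step (hM : M.IsMatching) (T : Transition M C A C')
    (hu : u ∈ M.verts) (h : askFirst M C u ≠ ⊤) (huA : (u, .update) ∉ A)
    (hvA : (mate M u, .update) ∉ A) :
    ind (Moves A u) + ind (Moves A (mate M u)) + firstWeight M C' u ≤ firstWeight M C u := by
  have hv := mate_mem hM hu
  obtain ⟨a1, a2⟩ := T.asks hM hu huA hvA
  obtain ⟨a3, a4⟩ := T.asks hM hv hvA (by rwa [mate_mate hM hu])
  have hus := askSecond_of_askFirst hM hu h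
  have hvf := askFirst_mate hM hu h
  unfold firstWeight
  rw [a1, a4]
  have eU : WellFormed M C u → (PointedBack C u ↔ Engaged M C u) := fun hw =>
    ⟨engaged_of_pointedBack hw.2.2.2.2, Engaged.pointedBack⟩
  have eV : WellFormed M C (mate M u) →
      (PointedBack C (mate M u) ↔ Engaged M C (mate M u)) := fun hw =>
    ⟨engaged_of_pointedBack hw.2.2.2.2, Engaged.pointedBack⟩
  have stepU : (¬ Moves A u ∧ C' u = C u) ∨ (Moves A u ∧ WellFormed M C u ∧
      Guard M C u .matchFirst ∧ C' u = command M C u .matchFirst) := by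
    rcases T.cases_matched hu with ⟨g1, -, g2⟩ | ⟨-, g1, -, -⟩ | ⟨g0, -, -, g1, g2⟩
    · exact Or.inl ⟨g1, g2⟩
    · exact absurd g1 huA
    · rcases g2 with ⟨hg, g2⟩ | ⟨hg, -⟩ | ⟨⟨-, hg⟩, -⟩
      · exact Or.inr ⟨g0, g1, hg, g2⟩
      · exact absurd hus hg.2.1
      · rcases hg with hg | hg
        · exact absurd hg.1 h
        · exact absurd hus hg.1
  refine weight_step ?_ ?_ ?_ ?_ ?_ ?_ ?_ ?_
  · intro h1; rw [h1]
  · intro h1; rw [h1]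
  · rintro h1 ⟨h2, h3⟩; exact h1 (h2.symm.trans h3)
  · rintro h1 ⟨h2, h3⟩; exact h1 (h2.symm.trans h3)
  · rintro ⟨h1, h2⟩
    have hp : (C' u).p = askFirst M C u := by
      rcases stepU with ⟨-, h3⟩ | ⟨-, -, -, h3⟩
      · rw [h3, h1]
      · rw [h3]; rfl
    exact ⟨hp, T.engaged hu h2 (hp.trans h1.symm)⟩
  · rintro ⟨h1, h2⟩ h3
    exact T.engaged hv h3 (h2.trans h1.symm)
  · rcases stepU with ⟨h1, h2⟩ | ⟨h1, h2, h3, h4⟩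
    · exact Or.inl ⟨h1, by rw [h2], by rw [h2], by rw [h2]⟩
    · right
      have e1 : FirstS M C u ↔ ((C u).p = askFirst M C u ∧ Engaged M C u) ∧
          ((C (mate M u)).p = askSecond M C (mate M u) ∨ (C (mate M u)).p = ⊤) := by
        unfold FirstS; rw [eU h2, and_assoc]
      have e2 : FirstEnd M C u ↔ ((C u).p = askFirst M C u ∧ Engaged M C u) ∧ (C u).s = true ∧
          (C (mate M u)).p = askSecond M C (mate M u) ∧ (C (mate M u)).fin = true := by
        unfold FirstEnd; rw [eU h2, and_assoc]
      rw [← e1, ← e2]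
      refine ⟨h1, by rw [h4]; rfl, by simp [h4, command], by simp [h4, command], ?_⟩
      rintro ⟨k1, k2, k3⟩
      rcases h3.2.2 with k | k | k
      exacts [k k1, k k2, k k3]
  · rcases T.cases_matched hv with ⟨g1, -, g2⟩ | ⟨-, g1, -, -⟩ | ⟨g0, -, -, g1, g2⟩
    · exact Or.inl ⟨g1, by rw [g2], by rw [g2], by rw [g2], by rw [g2]⟩
    · exact absurd g1 hvA
    · right
      rcases g2 with ⟨hg, -⟩ | ⟨⟨-, k1, k2, k3⟩, g2⟩ | ⟨⟨-, hg⟩, g2⟩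
      · exact absurd hvf hg.2.1
      · left
        have e1 : SecondEnd M C (mate M u) ↔ (C (mate M u)).p = askSecond M C (mate M u) ∧
            Engaged M C (mate M u) ∧ (C u).p = askFirst M C u := by
          unfold SecondEnd; rw [eV g1, mate_mate hM hu]
        rw [← e1]
        rw [mate_mate hM hu] at k2
        refine ⟨g0, k1, k2, by rw [g2]; rfl, by simp [g2, command], by simp [g2, command], ?_⟩
        rintro ⟨l1, l2, l3⟩
        rcases k3 with k | k | k
        exacts [k l1, k l2, k (Bool.eq_iff_iff.2 l3)]
      · right
        refine ⟨g0, by rw [g2]; rfl, by simp [g2, command], by simp [g2, command], ?_⟩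
        rw [mate_mate hM hu] at hg
        rcases hg with ⟨-, k1, k2⟩ | ⟨k1, k2, k3⟩
        · exact Or.inl ⟨k1, by simpa using k2⟩
        · exact Or.inr ⟨k1, k2, by simp [k3]⟩

/-- The state that `ResetMatch` establishes. -/
def IsReset (C : Config V) (u : V) : Prop :=
  (C u).p = ⊤ ∧ (C u).s = false ∧ (C u).fin = false

theorem Transition.reset_step (T : Transition M C A C') (hu : u ∈ M.verts)
    (h : askFirst M C u = ⊤) (h' : askSecond M C u = ⊤) (huA : (u, .update) ∉ A) :
    ind (Moves A u) + ind (¬ IsReset C' u) ≤ ind (¬ IsReset C u) := by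
  rcases T.cases_matched hu with ⟨g1, -, g2⟩ | ⟨-, g1, -, -⟩ | ⟨-, -, -, -, g2⟩
  · unfold IsReset
    rw [ind_false g1, g2, zero_add]
  · exact absurd g1 huA
  · rcases g2 with ⟨hg, -⟩ | ⟨hg, -⟩ | ⟨⟨-, hg⟩, g2⟩
    · exact absurd h hg.2.1
    · exact absurd h' hg.2.1
    · rcases hg with hg | hg
      · have h1 : IsReset C' u := by simp [IsReset, g2, command]
        rw [ind_true (show ¬ IsReset C u from hg.2.2), ind_false (not_not.2 h1)]
        exact ind_le_one _
      · exact absurd h' hg.1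

/-- The potential of a matching edge that bounds the number of its moves between two updates. -/
noncomputable def edgePot (M : G.Subgraph) (C : Config V) (u : V) : ℕ :=
  open Classical in
  if askFirst M C u ≠ ⊤ then firstWeight M C u
  else if askFirst M C (mate M u) ≠ ⊤ then firstWeight M C (mate M u)
  else ind (¬ IsReset C u) + ind (¬ IsReset C (mate M u))

theorem edgePot_le : edgePot M C u ≤ 318 := by
  unfold edgePot
  have h1 := ind_le_one (¬ IsReset C u)
  have h2 := ind_le_one (¬ IsReset C (mate M u))
  split_ifs
  · exact weight_le _ _ _ _ _ _ _ _ _ _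
  · exact weight_le _ _ _ _ _ _ _ _ _ _
  · omega

/-- The constant 320 is the largest potential, 318, plus one move for each end: an `Update` may
recreate the whole potential. -/
theorem Transition.edge_step (hM : M.IsMatching) (T : Transition M C A C') (hu : u ∈ M.verts) :
    ind (Moves A u) + ind (Moves A (mate M u)) + edgePot M C' u ≤ edgePot M C u +
      320 * (ind ((u, .update) ∈ A) + ind ((mate M u, .update) ∈ A)) := by
  have hv := mate_mem hM hu
  by_cases hA : (u, Rule.update) ∈ A ∨ (mate M u, Rule.update) ∈ A
  · have h1 := ind_le_one (Moves A u)
    have h2 := ind_le_one (Moves A (mate M u))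
    have h3 := edgePot_le (M := M) (C := C') (u := u)
    rcases hA with hA | hA <;> rw [ind_true hA] <;> omega
  · rw [not_or] at hA
    obtain ⟨huA, hvA⟩ := hA
    rw [ind_false huA, ind_false hvA]
    obtain ⟨a1, a2⟩ := T.asks hM hu huA hvA
    obtain ⟨a3, a4⟩ := T.asks hM hv hvA (by rwa [mate_mate hM hu])
    unfold edgePot
    rw [a1, a3]
    split_ifs with h1 h2
    · exact T.firstWeight_step hM hu h1 huA hvA
    · have := T.firstWeight_step hM hv h2 hvA (by rwa [mate_mate hM hu])
      rw [mate_mate hM hu] at this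
      omega
    · rw [not_not] at h1 h2
      have k1 : askSecond M C u = ⊤ := by
        by_contra h; exact askSecond_ne_top h h2
      have k2 : askSecond M C (mate M u) = ⊤ := by
        by_contra h
        have := askSecond_ne_top h
        rw [mate_mate hM hu] at this
        exact this h1
      have r1 := T.reset_step hu h1 k1 huA
      have r2 := T.reset_step hv h2 k2 hvA
      omega

/-- The total potential of the matching edges. -/
noncomputable def totalEdgePot (M : G.Subgraph) (C : Config V) : ℕ :=
  ∑ u ∈ covered M, edgePot M C u

theorem sum_covered_mate (hM : M.IsMatching) (f : V → ℕ) :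
    ∑ u ∈ covered M, f (mate M u) = ∑ u ∈ covered M, f u :=
  Finset.sum_nbij' (mate M) (mate M)
    (fun _ h => mem_covered.2 (mate_mem hM (mem_covered.1 h)))
    (fun _ h => mem_covered.2 (mate_mem hM (mem_covered.1 h)))
    (fun _ h => mate_mate hM (mem_covered.1 h)) (fun _ h => mate_mate hM (mem_covered.1 h))
    (fun _ _ => rfl)

/-- Summing over all covered nodes counts each edge from both ends. This doubles 320 to 640, while
one of the two copies of the moves is dropped. -/
theorem Transition.matchedMoves_le (hM : M.IsMatching) (T : Transition M C A C') :
    matchedMoves M A + totalEdgePot M C' ≤ totalEdgePot M C + 640 * updateMoves M A := by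
  have h := Finset.sum_le_sum (fun u (hu : u ∈ covered M) => T.edge_step hM (mem_covered.1 hu))
  simp only [Finset.sum_add_distrib, ← Finset.mul_sum] at h
  rw [sum_covered_mate hM (fun u => ind (Moves A u)),
    sum_covered_mate hM (fun u => ind ((u, Rule.update) ∈ A))] at h
  unfold matchedMoves totalEdgePot updateMoves
  omega

/-- The global potential. -/
noncomputable def potential (M : G.Subgraph) (C : Config V) : ℕ :=
  updatePPot M C + 3 * totalEdgePot M C + 1920 * updatePot M C +
    (1920 * Fintype.card V + 1) * (finPot M C + 2 * offerPot M C + 2 * totalAnnouncePot M C)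

/-- The coefficients follow the chain of causes. A matched move costs 1 + 2 through `UpdateP`, an
`Update` costs 3 · 640 = 1920, and a flip costs 1920 per node for the updates it causes plus 1 for
itself. Rises, and through them offers and announcements, count twice because of `flips_le`. -/
theorem Transition.card_add_potential_le (hM : Maximal SimpleGraph.Subgraph.IsMatching M)
    (T : Transition M C A C') : A.card + potential M C' ≤ potential M C := by
  have h0 : A.card ≤ matchedMoves M A + updatePMoves M A + flips M C C' := by
    rw [T.card_eq, ← sum_covered_add_sum_uncovered (M := M)]
    have := T.uncovered_moves_le
    unfold matchedMoves
    omega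
  have h1 := T.updatePMoves_le hM
  have h2 := T.matchedMoves_le hM.1
  have h3 := T.updateMoves_le
  have h4 := flips_le M C C'
  have h5 := T.rises_le
  have h6 := T.announcements_le hM.1
  have h7 : flips M C C' + (finPot M C' + 2 * offerPot M C' + 2 * totalAnnouncePot M C') ≤
      finPot M C + 2 * offerPot M C + 2 * totalAnnouncePot M C := by omega
  have h8 := Nat.mul_le_mul_left (1920 * Fintype.card V + 1) h7
  rw [mul_add] at h8
  have h9 : (1920 * Fintype.card V + 1) * flips M C C' =
    1920 * (Fintype.card V * flips M C C') + flips M C C' := by ring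
  unfold potential
  omega

theorem sum_le_mul_card (s : Finset V) (f : V → ℕ) (c : ℕ) (h : ∀ u, f u ≤ c) :
    ∑ u ∈ s, f u ≤ c * Fintype.card V := by
  refine (Finset.sum_le_card_nsmul s f c (fun u _ => h u)).trans ?_
  rw [smul_eq_mul, mul_comm]
  exact Nat.mul_le_mul_left _ (Finset.card_le_univ _)

theorem potential_le (M : G.Subgraph) (C : Config V) :
    potential M C ≤ 60000 * Fintype.card V ^ 3 := by
  have h1 : updatePPot M C ≤ 1 * Fintype.card V := sum_le_mul_card _ _ _ (fun _ => ind_le_one _)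
  have h2 : totalEdgePot M C ≤ 318 * Fintype.card V :=
    sum_le_mul_card _ _ _ (fun _ => edgePot_le)
  have h3 : updatePot M C ≤ 1 * Fintype.card V := sum_le_mul_card _ _ _ (fun _ => ind_le_one _)
  have h4 : finPot M C ≤ 1 * Fintype.card V := sum_le_mul_card _ _ _ (fun _ => ind_le_one _)
  have h5 : offerPot M C ≤ 1 * Fintype.card V := sum_le_mul_card _ _ _ (fun _ => ind_le_one _)
  have h6 : totalAnnouncePot M C ≤ 12 * Fintype.card V :=
    sum_le_mul_card _ _ _ (fun _ => announcePot_le)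
  have h7 := Nat.mul_le_mul_left (1920 * Fintype.card V + 1)
    -- Here 27 = 1 + 2 · 1 + 2 · 12.
    (show finPot M C + 2 * offerPot M C + 2 * totalAnnouncePot M C ≤ 27 * Fintype.card V by omega)
  have h8 : (1920 * Fintype.card V + 1) * (27 * Fintype.card V) =
      51840 * Fintype.card V ^ 2 + 27 * Fintype.card V := by ring
  have h9 : Fintype.card V ≤ Fintype.card V ^ 3 := Nat.le_self_pow (by norm_num) _
  have h10 : Fintype.card V ^ 2 ≤ Fintype.card V ^ 3 := by
    rcases Nat.eq_zero_or_pos (Fintype.card V) with h | h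
    · simp [h]
    · exact Nat.pow_le_pow_right h (by norm_num)
  unfold potential
  omega

theorem Execution.moves_add_potential_le (hM : Maximal SimpleGraph.Subgraph.IsMatching M)
    (E : Execution M) (k : ℕ) (hk : (k : ℕ∞) ≤ E.length) :
    E.moves k + potential M (E.config k) ≤ potential M (E.config 0) := by
  induction k with
  | zero => simp [Execution.moves]
  | succ k ih =>
    have hlt : (k : ℕ∞) < E.length := lt_of_lt_of_le (by exact_mod_cast Nat.lt_succ_self k) hk
    have h1 := ih hlt.le
    have h2 := (E.step k hlt).card_add_potential_le hM
    unfold Execution.moves at h1 ⊢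
    rw [Finset.sum_range_succ]
    omega

/-- Every transition executes at least one rule, so a bound on moves also bounds the length. -/
theorem Execution.le_moves (E : Execution M) (k : ℕ) (hk : (k : ℕ∞) ≤ E.length) :
    k ≤ E.moves k := by
  induction k with
  | zero => exact Nat.zero_le _
  | succ k ih =>
    have hlt : (k : ℕ∞) < E.length := lt_of_lt_of_le (by exact_mod_cast Nat.lt_succ_self k) hk
    have h1 := ih hlt.le
    have h2 := (E.step k hlt).nonempty.card_pos
    unfold Execution.moves at h1 ⊢
    rw [Finset.sum_range_succ]
    omega

end Edges

end MaxMatch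

theorem mainTheorem1 :
    ∃ c : ℕ, ∀ (V : Type*) [Fintype V] [LinearOrder V] (G : SimpleGraph V) (M : G.Subgraph),
      Maximal SimpleGraph.Subgraph.IsMatching M →
      ∀ E : MaxMatch.Execution M, E.IsMaximal →
        ∃ k : ℕ, E.length = k ∧ MaxMatch.Stable M (E.config k) ∧
          E.moves k ≤ c * Fintype.card V ^ 3 := by
  refine ⟨60000, fun V _ _ G M hM E hE => ?_⟩
  have hbound : ∀ k : ℕ, (k : ℕ∞) ≤ E.length → E.moves k ≤ 60000 * Fintype.card V ^ 3 :=
    fun k hk => (Nat.le_add_right _ _).trans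
      ((E.moves_add_potential_le hM k hk).trans (MaxMatch.potential_le M _))
  rcases hE with h | ⟨k, h1, h2⟩
  · have h3 : ((60000 * Fintype.card V ^ 3 + 1 : ℕ) : ℕ∞) ≤ E.length := h ▸ le_top
    have h4 := hbound _ h3
    have h5 := E.le_moves _ h3
    omega
  · exact ⟨k, h1, h2, hbound k h1.ge⟩
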